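/- Let $r\geqslant 3$ be an integer, let $q=e^{2\pi i/r}$, and set $r'=r/\gcd(r,2)$ and $r''=r/\gcd(r,4)$. For integers $k$ and $n\geqslant 0$ write $\{k\}=q^k-q^{-k}$, $[k]=\{k\}/\{1\}$, $[n]!=[n][n-1]\cdots[1]$. Let $u_q\mathfrak{sl}_2$ be the Hopf algebra over $\mathbb{C}$ with generators $K,K^{-1},E,F$, relations \[ KK^{-1}=K^{-1}K=1,\quad KEK^{-1}=q^2E,\quad KFK^{-1}=q^{-2}F,\quad [E,F]=\frac{K-K^{-1}}{q-q^{-1}},\quad K^{r'}=1,\quad E^{r'}=F^{r'}=0, \] and coproduct, counit and antipode \[ \Delta(K)=K\otimes K,\quad \Delta(E)=E\otimes K+1\otimes E,\quad \Delta(F)=F\otimes 1+K^{-1}\otimes F, \] \[ \varepsilon(K)=1,\quad \varepsilon(E)=\varepsilon(F)=0,\quad S(K)=K^{-1},\quad S(E)=-EK^{-1},\quad S(F)=-KF. \] Let \[ R=\sum_i R'_i\otimes R''_i=\frac{1}{r'}\sum_{a,b,c=0}^{r'-1}\frac{\{1\}^a}{[a]!}\,q^{\frac{a(a-1)}{2}-2bc}\,K^bE^a\otimes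 K^cF^a \] be its R-matrix, $u=\sum_i S(R''_i)R'_i$ its Drinfeld element, and $v_+=uK^{-1}$ its ribbon element (corresponding to the pivotal element $K$). There is a unique linear form $\lambda$ on $u_q\mathfrak{sl}_2$ such that \[ \lambda(E^aF^bK^c)=\frac{\sqrt{r''}\,[r'-1]!}{\{1\}^{r'-1}}\,\delta_{a,r'-1}\,\delta_{b,r'-1}\,\delta_{c,r'-1}\qquad(0\leqslant a,b,c\leqslant r'-1). \] It is a left integral, that is, $\lambda(x_{(2)})x_{(1)}=\lambda(x)1$ for every $x\in u_q\mathfrak{sl}_2$, and the positive stabilization coefficient $\lambda(v_+)$ is given by \[ \lambda(v_+)=\begin{cases} i^{\frac{r-1}{2}}q^{\frac{r+3}{2}} & \text{if } r\equiv 1 \bmod 2,\\ \left(\frac{2}{r'}\right)i^{\frac{r'-1}{2}}q^{\frac{r'+3}{2}} & \text{if } r\equiv 2\bmod 4,\\ -q^{\frac{r''+3}{2}} & \text{if } r\equiv 4\bmod 8,\\ 0 & \text{if } r\equiv 0\bmod 8, \end{cases} \] where $\left(\frac{2}{r'}\right)$ denotes the Jacobi symbol of $2$ modulo $r'$. -/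

import Mathlib

open scoped TensorProduct

namespace SmallQuantum

noncomputable section

/-! ### Scalars -/

/-- The root of unity `q = exp (2πi / r)`. -/
def q (r : ℕ) : ℂ := Complex.exp (2 * Real.pi * Complex.I / r)

/-- `r' = r / gcd(r, 2)`. -/
def r' (r : ℕ) : ℕ := r / Nat.gcd r 2

/-- `r'' = r / gcd(r, 4)`. -/
def r'' (r : ℕ) : ℕ := r / Nat.gcd r 4

/-- The quantum number `{k} = q^k - q^(-k)`. -/
def qBrace (r : ℕ) (k : ℤ) : ℂ := q r ^ k - q r ^ (-k)

/-- The quantum integer `[k] = {k} / {1}`. -/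
def qInt (r : ℕ) (k : ℤ) : ℂ := qBrace r k / qBrace r 1

/-- The quantum factorial `[n]! = [n] [n-1] ⋯ [1]`. -/
def qFact (r : ℕ) (n : ℕ) : ℂ := ∏ k ∈ Finset.range n, qInt r ((k : ℤ) + 1)

lemma q_ne_zero (r : ℕ) : q r ≠ 0 := Complex.exp_ne_zero _

lemma isPrimitiveRoot_q_sq {r : ℕ} (hr : r ≠ 0) : IsPrimitiveRoot (q r ^ 2) (r' r) := by
  have h : IsPrimitiveRoot (q r) r := Complex.isPrimitiveRoot_exp r hr
  rcases Nat.even_or_odd r with he | ho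
  · obtain ⟨m, hm⟩ := he.two_dvd
    have h2 : r' r = m := by
      have : Nat.gcd r 2 = 2 := Nat.gcd_eq_right ⟨m, hm⟩
      rw [r', this, hm]; omega
    rw [h2]
    exact h.pow (Nat.pos_of_ne_zero hr) hm
  · have hc : Nat.Coprime 2 r := (Nat.coprime_two_left).2 ho
    have h2 : r' r = r := by
      have : Nat.gcd r 2 = 1 := hc.symm
      rw [r', this, Nat.div_one]
    rw [h2]
    exact h.pow_of_coprime 2 hc

/-! ### The algebra `u_q sl₂` by generators and relations -/

/-- The generators. -/
inductive Gen
  | K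
  | Kinv
  | E
  | F

/-- The free generators. -/
abbrev fg (x : Gen) : FreeAlgebra ℂ Gen := FreeAlgebra.ι ℂ x

/-- The defining relations of `u_q sl₂`. -/
inductive Rel (r : ℕ) : FreeAlgebra ℂ Gen → FreeAlgebra ℂ Gen → Prop
  | K_Kinv : Rel r (fg .K * fg .Kinv) 1
  | Kinv_K : Rel r (fg .Kinv * fg .K) 1
  | K_E : Rel r (fg .K * fg .E * fg .Kinv) (q r ^ 2 • fg .E)
  | K_F : Rel r (fg .K * fg .F * fg .Kinv) ((q r ^ 2)⁻¹ • fg .F)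
  | E_F : Rel r (fg .E * fg .F - fg .F * fg .E) ((q r - (q r)⁻¹)⁻¹ • (fg .K - fg .Kinv))
  | K_pow : Rel r (fg .K ^ r' r) 1
  | E_pow : Rel r (fg .E ^ r' r) 0
  | F_pow : Rel r (fg .F ^ r' r) 0

/-- The small quantum group `u_q sl₂` at `q = exp (2πi / r)`. -/
def Uq (r : ℕ) : Type := RingQuot (Rel r)

instance (r : ℕ) : Ring (Uq r) := inferInstanceAs (Ring (RingQuot (Rel r)))

instance (r : ℕ) : Algebra ℂ (Uq r) := inferInstanceAs (Algebra ℂ (RingQuot (Rel r)))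

/-- The quotient map from the free algebra. -/
def mk (r : ℕ) : FreeAlgebra ℂ Gen →ₐ[ℂ] Uq r := RingQuot.mkAlgHom ℂ (Rel r)

/-- The generator `K`. -/
def K (r : ℕ) : Uq r := mk r (fg .K)

/-- The generator `K⁻¹`. -/
def Kinv (r : ℕ) : Uq r := mk r (fg .Kinv)

/-- The generator `E`. -/
def E (r : ℕ) : Uq r := mk r (fg .E)

/-- The generator `F`. -/
def F (r : ℕ) : Uq r := mk r (fg .F)

lemma mk_rel {r : ℕ} {x y : FreeAlgebra ℂ Gen} (h : Rel r x y) : mk r x = mk r y :=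
  RingQuot.mkAlgHom_rel ℂ h

lemma K_mul_Kinv (r : ℕ) : K r * Kinv r = 1 := by
  simpa [K, Kinv] using mk_rel (Rel.K_Kinv (r := r))

lemma Kinv_mul_K (r : ℕ) : Kinv r * K r = 1 := by
  simpa [K, Kinv] using mk_rel (Rel.Kinv_K (r := r))

lemma K_E_Kinv (r : ℕ) : K r * E r * Kinv r = q r ^ 2 • E r := by
  simpa [K, Kinv, E] using mk_rel (Rel.K_E (r := r))

lemma K_F_Kinv (r : ℕ) : K r * F r * Kinv r = (q r ^ 2)⁻¹ • F r := by
  simpa [K, Kinv, F] using mk_rel (Rel.K_F (r := r))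

lemma E_F_comm (r : ℕ) :
    E r * F r - F r * E r = (q r - (q r)⁻¹)⁻¹ • (K r - Kinv r) := by
  simpa [K, Kinv, E, F] using mk_rel (Rel.E_F (r := r))

lemma K_pow (r : ℕ) : K r ^ r' r = 1 := by
  simpa [K] using mk_rel (Rel.K_pow (r := r))

lemma E_pow (r : ℕ) : E r ^ r' r = 0 := by
  simpa [E] using mk_rel (Rel.E_pow (r := r))

lemma F_pow (r : ℕ) : F r ^ r' r = 0 := by
  simpa [F] using mk_rel (Rel.F_pow (r := r))

lemma Kinv_pow (r : ℕ) : Kinv r ^ r' r = 1 := by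
  have hc : Commute (K r) (Kinv r) := by rw [Commute, SemiconjBy, K_mul_Kinv, Kinv_mul_K]
  have h := hc.mul_pow (r' r)
  rw [K_mul_Kinv, K_pow, one_pow, one_mul] at h
  exact h.symm

lemma K_mul_E (r : ℕ) : K r * E r = q r ^ 2 • (E r * K r) := by
  have h := congrArg (· * K r) (K_E_Kinv r)
  simpa [mul_assoc, Kinv_mul_K] using h

lemma K_mul_F (r : ℕ) : K r * F r = (q r ^ 2)⁻¹ • (F r * K r) := by
  have h := congrArg (· * K r) (K_F_Kinv r)
  simpa [mul_assoc, Kinv_mul_K] using h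

lemma E_mul_Kinv (r : ℕ) : E r * Kinv r = q r ^ 2 • (Kinv r * E r) := by
  have h := congrArg (Kinv r * ·) (K_E_Kinv r)
  simpa [← mul_assoc, Kinv_mul_K] using h

lemma F_mul_Kinv (r : ℕ) : F r * Kinv r = (q r ^ 2)⁻¹ • (Kinv r * F r) := by
  have h := congrArg (Kinv r * ·) (K_F_Kinv r)
  simpa [← mul_assoc, Kinv_mul_K] using h

lemma Kinv_mul_E (r : ℕ) : Kinv r * E r = (q r ^ 2)⁻¹ • (E r * Kinv r) := by
  rw [E_mul_Kinv, smul_smul, inv_mul_cancel₀ (pow_ne_zero 2 (q_ne_zero r)), one_smul]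

lemma Kinv_mul_F (r : ℕ) : Kinv r * F r = q r ^ 2 • (F r * Kinv r) := by
  rw [F_mul_Kinv, smul_smul, mul_inv_cancel₀ (pow_ne_zero 2 (q_ne_zero r)), one_smul]

/-- Four elements of an algebra satisfying the relations of `u_q sl₂`. -/
structure IsRep (r : ℕ) {A : Type} [Ring A] [Algebra ℂ A] (k l e f : A) : Prop where
  kl : k * l = 1
  lk : l * k = 1
  ke : k * e = q r ^ 2 • (e * k)
  kf : k * f = (q r ^ 2)⁻¹ • (f * k)
  ef : e * f - f * e = (q r - (q r)⁻¹)⁻¹ • (k - l)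
  kp : k ^ r' r = 1
  ep : e ^ r' r = 0
  fp : f ^ r' r = 0

/-- The images of the generators. -/
def genMap {A : Type} (k l e f : A) : Gen → A
  | .K => k
  | .Kinv => l
  | .E => e
  | .F => f

/-- The universal property of `u_q sl₂`. -/
def lift (r : ℕ) {A : Type} [Ring A] [Algebra ℂ A] {k l e f : A} (h : IsRep r k l e f) :
    Uq r →ₐ[ℂ] A :=
  RingQuot.liftAlgHom ℂ ⟨FreeAlgebra.lift ℂ (genMap k l e f), by
    intro x y hxy
    cases hxy with
    | K_Kinv => simpa [genMap] using h.kl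
    | Kinv_K => simpa [genMap] using h.lk
    | K_E =>
      have h1 : k * e * l = q r ^ 2 • e := by rw [h.ke, smul_mul_assoc, mul_assoc, h.kl, mul_one]
      simpa [genMap] using h1
    | K_F =>
      have h1 : k * f * l = (q r ^ 2)⁻¹ • f := by
        rw [h.kf, smul_mul_assoc, mul_assoc, h.kl, mul_one]
      simpa [genMap] using h1
    | E_F => simpa [genMap] using h.ef
    | K_pow => simpa [genMap] using h.kp
    | E_pow => simpa [genMap] using h.ep
    | F_pow => simpa [genMap] using h.fp⟩

section lift

variable (r : ℕ) {A : Type} [Ring A] [Algebra ℂ A] {k l e f : A} (h : IsRep r k l e f)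

lemma lift_mk (x : FreeAlgebra ℂ Gen) :
    lift r h (mk r x) = FreeAlgebra.lift ℂ (genMap k l e f) x :=
  RingQuot.liftAlgHom_mkAlgHom_apply _ _ _ _

@[simp] lemma lift_K : lift r h (K r) = k := by simp [K, lift_mk, genMap]

@[simp] lemma lift_Kinv : lift r h (Kinv r) = l := by simp [Kinv, lift_mk, genMap]

@[simp] lemma lift_E : lift r h (E r) = e := by simp [E, lift_mk, genMap]

@[simp] lemma lift_F : lift r h (F r) = f := by simp [F, lift_mk, genMap]

end lift

lemma algHom_ext {r : ℕ} {A : Type} [Ring A] [Algebra ℂ A] {φ ψ : Uq r →ₐ[ℂ] A}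
    (hK : φ (K r) = ψ (K r)) (hKinv : φ (Kinv r) = ψ (Kinv r))
    (hE : φ (E r) = ψ (E r)) (hF : φ (F r) = ψ (F r)) : φ = ψ := by
  refine RingQuot.ringQuot_ext' (S := ℂ) φ ψ (FreeAlgebra.hom_ext (funext fun x => ?_))
  cases x with
  | K => exact hK
  | Kinv => exact hKinv
  | E => exact hE
  | F => exact hF

/-- Induction over `u_q sl₂`. -/
lemma induction_on {r : ℕ} {P : Uq r → Prop} (x : Uq r) (hc : ∀ c : ℂ, P (algebraMap ℂ _ c))
    (hK : P (K r)) (hKinv : P (Kinv r)) (hE : P (E r)) (hF : P (F r))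
    (hadd : ∀ a b, P a → P b → P (a + b)) (hmul : ∀ a b, P a → P b → P (a * b)) : P x := by
  obtain ⟨y, rfl⟩ := RingQuot.mkAlgHom_surjective ℂ (Rel r) x
  change P (mk r y)
  induction y using FreeAlgebra.induction with
  | grade0 c => rw [AlgHom.commutes]; exact hc c
  | grade1 x =>
    cases x with
    | K => exact hK
    | Kinv => exact hKinv
    | E => exact hE
    | F => exact hF
  | mul a b ha hb => rw [map_mul]; exact hmul _ _ ha hb
  | add a b ha hb => rw [map_add]; exact hadd _ _ ha hb

/-! ### Powers of `ω`-commuting elements -/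

/-- The Gaussian binomial coefficient of `i + j` over `i` at `ω`. -/
def gauss (ω : ℂ) : ℕ → ℕ → ℂ
  | 0, _ => 1
  | _ + 1, 0 => 1
  | i + 1, j + 1 => gauss ω i (j + 1) + ω ^ (i + 1) * gauss ω (i + 1) j

lemma gauss_zero_right (ω : ℂ) (i : ℕ) : gauss ω i 0 = 1 := by cases i <;> simp [gauss]

lemma gauss_zero_left (ω : ℂ) (j : ℕ) : gauss ω 0 j = 1 := by simp [gauss]

lemma gauss_succ_succ (ω : ℂ) (i j : ℕ) :
    gauss ω (i + 1) (j + 1) = gauss ω i (j + 1) + ω ^ (i + 1) * gauss ω (i + 1) j := by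
  rw [gauss]

lemma gauss_step (ω : ℂ) (n : ℕ) : ∀ i j : ℕ, i + j = n →
    (1 - ω ^ (i + 1)) * gauss ω (i + 1) j = (1 - ω ^ (i + j + 1)) * gauss ω i j ∧
    (1 - ω ^ (j + 1)) * gauss ω i (j + 1) = (1 - ω ^ (i + j + 1)) * gauss ω i j := by
  induction n with
  | zero =>
    intro i j h
    obtain ⟨rfl, rfl⟩ : i = 0 ∧ j = 0 := by omega
    simp [gauss_zero_left, gauss_zero_right]
  | succ n ih =>
    intro i j h
    constructor
    · cases j with
      | zero => simp [gauss_zero_right]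
      | succ j =>
        obtain ⟨hA, hB⟩ := ih i j (by omega)
        rw [gauss_succ_succ]
        have e1 : ω ^ (i + (j + 1) + 1) = ω ^ (i + 1) * ω ^ (j + 1) := by ring
        rw [e1]
        linear_combination ω ^ (i + 1) * hA - ω ^ (i + 1) * hB
    · cases i with
      | zero => simp [gauss_zero_left]
      | succ i =>
        obtain ⟨hA, hB⟩ := ih i j (by omega)
        rw [gauss_succ_succ]
        have e1 : ω ^ (i + 1 + j + 1) = ω ^ (i + 1) * ω ^ (j + 1) := by ring
        rw [e1]
        linear_combination hB - hA

section qcomm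

variable {A : Type} [Ring A] [Algebra ℂ A] {x y : A} {ω : ℂ}

lemma mul_pow_qcomm (h : y * x = ω • (x * y)) (n : ℕ) : y * x ^ n = ω ^ n • (x ^ n * y) := by
  induction n with
  | zero => simp
  | succ n ih =>
    rw [pow_succ, ← mul_assoc, ih, smul_mul_assoc, mul_assoc, h, mul_smul_comm, smul_smul,
      pow_succ, mul_assoc]

lemma add_pow_qcomm (h : y * x = ω • (x * y)) (n : ℕ) :
    (x + y) ^ n =
      ∑ p ∈ Finset.HasAntidiagonal.antidiagonal n, gauss ω p.1 p.2 • (x ^ p.1 * y ^ p.2) := by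
  induction n with
  | zero => simp [gauss_zero_left]
  | succ n ih =>
    have hx : ∀ i j : ℕ, x * (gauss ω i j • (x ^ i * y ^ j)) =
        gauss ω i j • (x ^ (i + 1) * y ^ j) := by
      intro i j
      rw [mul_smul_comm, ← mul_assoc, ← pow_succ']
    have hy : ∀ i j : ℕ, y * (gauss ω i j • (x ^ i * y ^ j)) =
        (ω ^ i * gauss ω i j) • (x ^ i * y ^ (j + 1)) := by
      intro i j
      rw [mul_smul_comm, ← mul_assoc, mul_pow_qcomm h, smul_mul_assoc, smul_smul, mul_assoc,
        ← pow_succ', mul_comm]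
    rw [pow_succ', ih, add_mul, Finset.mul_sum, Finset.mul_sum]
    simp only [hx, hy]
    let a : ℕ → ℕ → ℂ := fun i j => Nat.casesOn i 0 (fun i => gauss ω i j)
    let b : ℕ → ℕ → ℂ := fun i j => Nat.casesOn j 0 (fun j => ω ^ i * gauss ω i j)
    have hab : ∀ p ∈ Finset.HasAntidiagonal.antidiagonal (n + 1),
        gauss ω p.1 p.2 • (x ^ p.1 * y ^ p.2) =
          a p.1 p.2 • (x ^ p.1 * y ^ p.2) + b p.1 p.2 • (x ^ p.1 * y ^ p.2) := by
      rintro ⟨i, j⟩ hp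
      rw [Finset.HasAntidiagonal.mem_antidiagonal] at hp
      rw [← add_smul]
      congr 1
      rcases i with _ | i <;> rcases j with _ | j
      · simp at hp
      · simp [a, b, gauss_zero_left]
      · simp [a, b, gauss_zero_right]
      · simp [a, b, gauss_succ_succ]
    rw [Finset.sum_congr rfl hab, Finset.sum_add_distrib, Finset.Nat.sum_antidiagonal_succ,
      Finset.Nat.sum_antidiagonal_succ']
    simp [a, b]

lemma add_pow_eq_zero {n : ℕ} (hω : n ≠ 0 → IsPrimitiveRoot ω n) (h : y * x = ω • (x * y))
    (hx : x ^ n = 0) (hy : y ^ n = 0) : (x + y) ^ n = 0 := by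
  rw [add_pow_qcomm h]
  refine Finset.sum_eq_zero fun p hp => ?_
  obtain ⟨i, j⟩ := p
  rw [Finset.HasAntidiagonal.mem_antidiagonal] at hp
  simp only at hp ⊢
  rcases Nat.eq_zero_or_pos i with rfl | hi
  · obtain rfl : j = n := by omega
    simp [hy]
  rcases Nat.eq_zero_or_pos j with rfl | hj
  · obtain rfl : i = n := by omega
    simp [hx]
  obtain ⟨i, rfl⟩ : ∃ m, i = m + 1 := ⟨i - 1, by omega⟩
  have hr := hω (by omega)
  have hA := (gauss_step ω (i + j) i j rfl).1
  have e : i + j + 1 = n := by omega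
  rw [e, hr.pow_eq_one, sub_self, zero_mul] at hA
  have hne : (1 : ℂ) - ω ^ (i + 1) ≠ 0 :=
    sub_ne_zero.2 (hr.pow_ne_one_of_pos_of_lt (by omega) (by omega)).symm
  rw [(mul_eq_zero.1 hA).resolve_left hne, zero_smul]

lemma mul_pow_eq_zero (h : y * x = ω • (x * y)) {n : ℕ} (hx : x ^ n = 0) :
    (x * y) ^ n = 0 := by
  have key : ∀ m : ℕ, ∃ c : ℂ, (x * y) ^ m = c • (x ^ m * y ^ m) := by
    intro m
    induction m with
    | zero => exact ⟨1, by simp⟩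
    | succ m ih =>
      obtain ⟨c, hc⟩ := ih
      refine ⟨c * ω ^ m, ?_⟩
      rw [pow_succ', hc, mul_smul_comm, mul_assoc, ← mul_assoc y, mul_pow_qcomm h,
        smul_mul_assoc, mul_smul_comm, smul_smul, mul_assoc (x ^ m), ← pow_succ', ← mul_assoc,
        ← pow_succ']
  obtain ⟨c, hc⟩ := key n
  rw [hc, hx, zero_mul, smul_zero]

end qcomm

lemma isPrimitiveRoot_of_r'_ne_zero {r : ℕ} (h : r' r ≠ 0) :
    IsPrimitiveRoot (q r ^ 2) (r' r) := by
  refine isPrimitiveRoot_q_sq ?_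
  rintro rfl
  exact h (by simp [r'])

/-! ### The Hopf algebra structure -/

lemma isRep_comul (r : ℕ) : IsRep r (A := Uq r ⊗[ℂ] Uq r)
    (K r ⊗ₜ K r) (Kinv r ⊗ₜ Kinv r) (E r ⊗ₜ K r + 1 ⊗ₜ E r) (F r ⊗ₜ 1 + Kinv r ⊗ₜ F r) where
  kl := by simp [K_mul_Kinv, Algebra.TensorProduct.one_def]
  lk := by simp [Kinv_mul_K, Algebra.TensorProduct.one_def]
  ke := by
    simp [mul_add, add_mul, K_mul_E, TensorProduct.smul_tmul', TensorProduct.tmul_smul]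
  kf := by
    simp [mul_add, add_mul, K_mul_F, TensorProduct.smul_tmul', TensorProduct.tmul_smul,
      K_mul_Kinv, Kinv_mul_K]
  ef := by
    have h := E_F_comm r
    rw [sub_eq_iff_eq_add] at h
    simp only [mul_add, add_mul, Algebra.TensorProduct.tmul_mul_tmul, one_mul, mul_one, h,
      E_mul_Kinv, K_mul_F, TensorProduct.add_tmul, TensorProduct.tmul_add,
      TensorProduct.smul_tmul', TensorProduct.tmul_smul, smul_smul, TensorProduct.sub_tmul,
      TensorProduct.tmul_sub, smul_sub]
    rw [inv_mul_cancel₀ (pow_ne_zero 2 (q_ne_zero r)), one_smul]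
    abel
  kp := by
    rw [Algebra.TensorProduct.tmul_pow, K_pow, Algebra.TensorProduct.one_def]
  ep := by
    rw [add_comm]
    refine add_pow_eq_zero (ω := q r ^ 2) isPrimitiveRoot_of_r'_ne_zero ?_ ?_ ?_
    · simp [K_mul_E]
    · rw [Algebra.TensorProduct.tmul_pow, E_pow, TensorProduct.tmul_zero]
    · rw [Algebra.TensorProduct.tmul_pow, E_pow, TensorProduct.zero_tmul]
  fp := by
    refine add_pow_eq_zero (ω := q r ^ 2) isPrimitiveRoot_of_r'_ne_zero ?_ ?_ ?_
    · simp [Kinv_mul_F, TensorProduct.smul_tmul']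
    · rw [Algebra.TensorProduct.tmul_pow, F_pow, TensorProduct.zero_tmul]
    · rw [Algebra.TensorProduct.tmul_pow, F_pow, TensorProduct.tmul_zero]

/-- The coproduct: `ΔK = K ⊗ K`, `ΔE = E ⊗ K + 1 ⊗ E`, `ΔF = F ⊗ 1 + K⁻¹ ⊗ F`. -/
def comulHom (r : ℕ) : Uq r →ₐ[ℂ] Uq r ⊗[ℂ] Uq r := lift r (isRep_comul r)

lemma r'_eq_zero {r : ℕ} (h : r' r = 0) : r = 0 := by
  by_contra hr
  have h1 : Nat.gcd r 2 ≤ r := Nat.gcd_le_left 2 (Nat.pos_of_ne_zero hr)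
  have h2 : 0 < Nat.gcd r 2 := Nat.gcd_pos_of_pos_left 2 (Nat.pos_of_ne_zero hr)
  have := Nat.div_pos h1 h2
  rw [r'] at h
  omega

lemma isRep_counit {r : ℕ} (hr : r ≠ 0) : IsRep r (A := ℂ) 1 1 0 0 where
  kl := by simp
  lk := by simp
  ke := by simp
  kf := by simp
  ef := by simp
  kp := by simp
  ep := zero_pow (fun h => hr (r'_eq_zero h))
  fp := zero_pow (fun h => hr (r'_eq_zero h))

/-- The counit: `ε(K) = 1`, `ε(E) = ε(F) = 0`. -/
def counitHom (r : ℕ) [NeZero r] : Uq r →ₐ[ℂ] ℂ := lift r (isRep_counit (NeZero.ne r))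

lemma isRep_antipode (r : ℕ) : IsRep r (A := (Uq r)ᵐᵒᵖ)
    (MulOpposite.op (Kinv r)) (MulOpposite.op (K r))
    (MulOpposite.op (-(E r * Kinv r))) (MulOpposite.op (-(K r * F r))) where
  kl := by rw [← MulOpposite.op_mul, K_mul_Kinv, MulOpposite.op_one]
  lk := by rw [← MulOpposite.op_mul, Kinv_mul_K, MulOpposite.op_one]
  ke := by
    rw [← MulOpposite.op_mul, ← MulOpposite.op_mul, ← MulOpposite.op_smul]
    congr 1
    rw [mul_neg, ← mul_assoc, neg_mul, E_mul_Kinv, smul_mul_assoc, smul_neg]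
  kf := by
    rw [← MulOpposite.op_mul, ← MulOpposite.op_mul, ← MulOpposite.op_smul]
    congr 1
    rw [mul_neg, ← mul_assoc, neg_mul, Kinv_mul_K, one_mul, K_mul_F, smul_mul_assoc, mul_assoc,
      K_mul_Kinv, mul_one, smul_neg]
  ef := by
    rw [← MulOpposite.op_mul, ← MulOpposite.op_mul, ← MulOpposite.op_sub, ← MulOpposite.op_sub,
      ← MulOpposite.op_smul]
    congr 1
    have h := E_F_comm r
    have h1 : -(K r * F r) * -(E r * Kinv r) = F r * E r := by
      rw [neg_mul_neg, K_mul_F, E_mul_Kinv, smul_mul_smul_comm,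
        inv_mul_cancel₀ (pow_ne_zero 2 (q_ne_zero r)), one_smul, mul_assoc, ← mul_assoc (K r),
        K_mul_Kinv, one_mul]
    have h2 : -(E r * Kinv r) * -(K r * F r) = E r * F r := by
      rw [neg_mul_neg, mul_assoc, ← mul_assoc (Kinv r), Kinv_mul_K, one_mul]
    rw [h1, h2, ← neg_sub, h, ← smul_neg, neg_sub]
  kp := by rw [← MulOpposite.op_pow, Kinv_pow, MulOpposite.op_one]
  ep := by
    rw [← MulOpposite.op_pow, neg_pow, mul_pow_eq_zero (Kinv_mul_E r) (E_pow r), mul_zero,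
      MulOpposite.op_zero]
  fp := by
    rw [← MulOpposite.op_pow, neg_pow, K_mul_F, smul_pow,
      mul_pow_eq_zero (K_mul_F r) (F_pow r), smul_zero, mul_zero, MulOpposite.op_zero]

/-- The antipode as an anti-homomorphism: `S(K) = K⁻¹`, `S(E) = -E K⁻¹`, `S(F) = -K F`. -/
def antipodeHom (r : ℕ) : Uq r →ₐ[ℂ] (Uq r)ᵐᵒᵖ := lift r (isRep_antipode r)

/-- The antipode as a linear map. -/
def antipodeLin (r : ℕ) : Uq r →ₗ[ℂ] Uq r :=
  (MulOpposite.opLinearEquiv ℂ).symm.toLinearMap ∘ₗ (antipodeHom r).toLinearMap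

lemma antipodeLin_mul (r : ℕ) (x y : Uq r) :
    antipodeLin r (x * y) = antipodeLin r y * antipodeLin r x := by
  simp [antipodeLin]

lemma antipodeLin_algebraMap (r : ℕ) (c : ℂ) :
    antipodeLin r (algebraMap ℂ _ c) = algebraMap ℂ _ c := by
  simp [antipodeLin, AlgHom.commutes, MulOpposite.algebraMap_apply]

lemma antipodeLin_one (r : ℕ) : antipodeLin r 1 = 1 := by
  simp [antipodeLin]

lemma antipodeLin_K (r : ℕ) : antipodeLin r (K r) = Kinv r := by
  simp [antipodeLin, antipodeHom]

lemma antipodeLin_Kinv (r : ℕ) : antipodeLin r (Kinv r) = K r := by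
  simp [antipodeLin, antipodeHom]

lemma antipodeLin_E (r : ℕ) : antipodeLin r (E r) = -(E r * Kinv r) := by
  simp [antipodeLin, antipodeHom]

lemma antipodeLin_F (r : ℕ) : antipodeLin r (F r) = -(K r * F r) := by
  simp [antipodeLin, antipodeHom]

instance instBialgebra (r : ℕ) [NeZero r] : Bialgebra ℂ (Uq r) :=
  Bialgebra.ofAlgHom (comulHom r) (counitHom r)
    (by
      apply algHom_ext <;>
        simp [comulHom, TensorProduct.add_tmul, TensorProduct.tmul_add,
          Algebra.TensorProduct.one_def, add_assoc])
    (by apply algHom_ext <;> simp [comulHom, counitHom])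
    (by apply algHom_ext <;> simp [comulHom, counitHom])

lemma comul_eq (r : ℕ) [NeZero r] (x : Uq r) : Coalgebra.comul (R := ℂ) x = comulHom r x := rfl

lemma counit_eq (r : ℕ) [NeZero r] (x : Uq r) : Coalgebra.counit (R := ℂ) x = counitHom r x := rfl

/-- The map `x ⊗ y ↦ S(x) z y`. -/
def leftConv (r : ℕ) (z : Uq r) : Uq r ⊗[ℂ] Uq r →ₗ[ℂ] Uq r :=
  LinearMap.mul' ℂ (Uq r) ∘ₗ
    TensorProduct.map (LinearMap.mulRight ℂ z ∘ₗ antipodeLin r) LinearMap.id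

/-- The map `x ⊗ y ↦ x z S(y)`. -/
def rightConv (r : ℕ) (z : Uq r) : Uq r ⊗[ℂ] Uq r →ₗ[ℂ] Uq r :=
  LinearMap.mul' ℂ (Uq r) ∘ₗ
    TensorProduct.map (LinearMap.mulRight ℂ z) (antipodeLin r)

lemma leftConv_mul (r : ℕ) (z : Uq r) (s t : Uq r ⊗[ℂ] Uq r) :
    leftConv r z (s * t) = leftConv r (leftConv r z s) t := by
  induction t using TensorProduct.induction_on with
  | zero => simp
  | add t1 t2 h1 h2 => rw [mul_add, map_add, map_add, h1, h2]
  | tmul a b =>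
    induction s using TensorProduct.induction_on with
    | zero => simp [leftConv]
    | add s1 s2 h1 h2 =>
      rw [add_mul, map_add, map_add, h1, h2]
      simp [leftConv, mul_add, add_mul]
    | tmul c d => simp [leftConv, antipodeLin_mul, mul_assoc]

lemma rightConv_mul (r : ℕ) (z : Uq r) (s t : Uq r ⊗[ℂ] Uq r) :
    rightConv r z (s * t) = rightConv r (rightConv r z t) s := by
  induction s using TensorProduct.induction_on with
  | zero => simp
  | add t1 t2 h1 h2 => rw [add_mul, map_add, map_add, h1, h2]
  | tmul a b =>
    induction t using TensorProduct.induction_on with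
    | zero => simp [rightConv]
    | add s1 s2 h1 h2 =>
      rw [mul_add, map_add, map_add, h1, h2]
      simp [rightConv, mul_add, add_mul]
    | tmul c d => simp [rightConv, antipodeLin_mul, mul_assoc]

lemma leftConv_smul (r : ℕ) (c : ℂ) (t : Uq r ⊗[ℂ] Uq r) :
    leftConv r (algebraMap ℂ _ c) t = c • leftConv r 1 t := by
  induction t using TensorProduct.induction_on with
  | zero => simp
  | add t1 t2 h1 h2 => rw [map_add, map_add, h1, h2, smul_add]
  | tmul a b => simp [leftConv, Algebra.algebraMap_eq_smul_one]

lemma rightConv_smul (r : ℕ) (c : ℂ) (t : Uq r ⊗[ℂ] Uq r) :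
    rightConv r (algebraMap ℂ _ c) t = c • rightConv r 1 t := by
  induction t using TensorProduct.induction_on with
  | zero => simp
  | add t1 t2 h1 h2 => rw [map_add, map_add, h1, h2, smul_add]
  | tmul a b => simp [rightConv, Algebra.algebraMap_eq_smul_one]

lemma leftConv_comul (r : ℕ) [NeZero r] (x : Uq r) :
    leftConv r 1 (comulHom r x) = algebraMap ℂ _ (counitHom r x) := by
  induction x using induction_on with
  | hc c =>
    rw [AlgHom.commutes, AlgHom.commutes, Algebra.algebraMap_eq_smul_one, map_smul,
      Algebra.TensorProduct.one_def]
    simp [leftConv, antipodeLin_one, Algebra.algebraMap_eq_smul_one]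
  | hK => simp [leftConv, comulHom, counitHom, antipodeLin_K, Kinv_mul_K]
  | hKinv => simp [leftConv, comulHom, counitHom, antipodeLin_Kinv, K_mul_Kinv]
  | hE =>
    simp [leftConv, comulHom, counitHom, antipodeLin_E, antipodeLin_one, mul_assoc, Kinv_mul_K]
  | hF => simp [leftConv, comulHom, counitHom, antipodeLin_F, antipodeLin_Kinv]
  | hadd a b ha hb => rw [map_add, map_add, ha, hb, map_add, map_add]
  | hmul a b ha hb =>
    rw [map_mul, leftConv_mul, ha, leftConv_smul, hb, map_mul, map_mul, Algebra.smul_def]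

lemma rightConv_comul (r : ℕ) [NeZero r] (x : Uq r) :
    rightConv r 1 (comulHom r x) = algebraMap ℂ _ (counitHom r x) := by
  induction x using induction_on with
  | hc c =>
    rw [AlgHom.commutes, AlgHom.commutes, Algebra.algebraMap_eq_smul_one, map_smul,
      Algebra.TensorProduct.one_def]
    simp [rightConv, antipodeLin_one, Algebra.algebraMap_eq_smul_one]
  | hK => simp [rightConv, comulHom, counitHom, antipodeLin_K, K_mul_Kinv]
  | hKinv => simp [rightConv, comulHom, counitHom, antipodeLin_Kinv, Kinv_mul_K]
  | hE => simp [rightConv, comulHom, counitHom, antipodeLin_E, antipodeLin_K]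
  | hF =>
    simp [rightConv, comulHom, counitHom, antipodeLin_F, antipodeLin_one, ← mul_assoc,
      Kinv_mul_K]
  | hadd a b ha hb => rw [map_add, map_add, ha, hb, map_add, map_add]
  | hmul a b ha hb =>
    rw [map_mul, rightConv_mul, hb, rightConv_smul, ha, map_mul, map_mul,
      Algebra.smul_def, Algebra.commutes]

/-- The Hopf algebra structure on `u_q sl₂`. -/
instance instHopfAlgebra (r : ℕ) [NeZero r] : HopfAlgebra ℂ (Uq r) where
  antipode := antipodeLin r
  mul_antipode_rTensor_comul := by
    ext x
    have h := leftConv_comul r x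
    have h1 : leftConv r 1 = LinearMap.mul' ℂ (Uq r) ∘ₗ (antipodeLin r).rTensor (Uq r) := by
      rw [leftConv, LinearMap.mulRight_one]; rfl
    rw [h1] at h
    exact h
  mul_antipode_lTensor_comul := by
    ext x
    have h := rightConv_comul r x
    have h1 : rightConv r 1 = LinearMap.mul' ℂ (Uq r) ∘ₗ (antipodeLin r).lTensor (Uq r) := by
      rw [rightConv, LinearMap.mulRight_one]; rfl
    rw [h1] at h
    exact h

/-! ### Integrals, R-matrix and ribbon element -/

/-- A left integral of a Hopf algebra `H`: a linear form with `λ(x₍₂₎) x₍₁₎ = λ(x) 1`. -/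
def IsLeftIntegral {H : Type} [Ring H] [HopfAlgebra ℂ H] (lam : H →ₗ[ℂ] ℂ) : Prop :=
  ∀ x : H, TensorProduct.rid ℂ H (lam.lTensor H (Coalgebra.comul x)) = lam x • (1 : H)

/-- The Drinfeld element `u = S(R'') R'` of `R = R' ⊗ R''`. -/
def drinfeldElement {H : Type} [Ring H] [HopfAlgebra ℂ H] (R : H ⊗[ℂ] H) : H :=
  LinearMap.mul' ℂ H ((HopfAlgebra.antipode ℂ (A := H)).rTensor H (TensorProduct.comm ℂ H H R))

/-- The R-matrix of `u_q sl₂`. -/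
def RMatrix (r : ℕ) : Uq r ⊗[ℂ] Uq r :=
  (1 / (r' r : ℂ)) •
    ∑ a ∈ Finset.range (r' r), ∑ b ∈ Finset.range (r' r), ∑ c ∈ Finset.range (r' r),
      (qBrace r 1 ^ a / qFact r a * q r ^ (((a * (a - 1) / 2 : ℕ) : ℤ) - 2 * b * c)) •
        ((K r ^ b * E r ^ a) ⊗ₜ[ℂ] (K r ^ c * F r ^ a))

/-- The ribbon element `v₊ = u g⁻¹` with pivotal element `g = K`. -/
def ribbonElement (r : ℕ) [NeZero r] : Uq r :=
  drinfeldElement (RMatrix r) * Kinv r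

/-- The value of the preferred integral on the monomials `E^a F^b K^c`, `0 ≤ a, b, c ≤ r' - 1`. -/
def IsPreferred (r : ℕ) (lam : Uq r →ₗ[ℂ] ℂ) : Prop :=
  ∀ a b c : ℕ, a < r' r → b < r' r → c < r' r →
    lam (E r ^ a * F r ^ b * K r ^ c) =
      if a = r' r - 1 ∧ b = r' r - 1 ∧ c = r' r - 1 then
        (Real.sqrt (r'' r) : ℂ) * qFact r (r' r - 1) / qBrace r 1 ^ (r' r - 1)
      else 0

end

end SmallQuantum

/-!
The monomials `E ^ i * F ^ j * K ^ x` with `i, j < r'` and `x ∈ ℤ / r'` span `u_q sl₂`, so a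
preferred form is unique. In the coproduct of such a monomial at most one term survives an
application of the form to the second factor, which makes it a left integral. It exists because the
monomials can be told apart by matrix coefficients: in a tensor product of two baby Verma modules
one factor detects `E ^ (r' - 1)` and the other `F ^ (r' - 1)`, and Fourier inversion over the
highest weight isolates the power of `K`.

In the integral of the ribbon element only the terms of the R-matrix with `a = r' - 1` and
`b = c + 1` contribute, which leaves the Gauss sum `∑ c, q ^ (-2 * c * (c + 1))` over `ℤ / r'`. For
`8 ∣ r` the shift of `c` by `r' / 2` changes the sign of every summand. In the other cases the sum
reduces, by completing the square or by periodicity, to an alternating sum of `ω`-binomial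
coefficients at a root of unity `ω` of odd order `n = 2 * p + 1`, which Gauss factors as
`∏ k < p, (1 - ω ^ (2 * k + 1))`. The square of its modulus is `∏ k < n - 1, (1 - ω ^ (k + 1)) = n`,
and the argument of `1 - w ^ 2` with `|w| = 1` and `0 ≤ im w` is that of `-i * w`.
-/

namespace SmallQuantum

noncomputable section

/-! ### The character `x ↦ q ^ (2 x)` of `ℤ / r'` -/

instance (r : ℕ) [NeZero r] : NeZero (r' r) := ⟨fun h => NeZero.ne r (r'_eq_zero h)⟩

lemma sum_range_natCast {A : Type*} [AddCommMonoid A] {N : ℕ} [NeZero N] (f : ZMod N → A) :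
    ∑ i ∈ Finset.range N, f i = ∑ x, f x :=
  Finset.sum_nbij' (fun i => (i : ZMod N)) ZMod.val (fun _ _ => Finset.mem_univ _)
    (fun x _ => Finset.mem_range.2 x.val_lt)
    (fun _ hi => ZMod.val_cast_of_lt (Finset.mem_range.1 hi))
    (fun x _ => ZMod.natCast_zmod_val x) fun _ _ => rfl

lemma natCast_eq_neg_one_iff {N i : ℕ} (hi : i < N) : (i : ZMod N) = -1 ↔ i = N - 1 := by
  rw [eq_neg_iff_add_eq_zero, ← Nat.cast_succ, ZMod.natCast_eq_zero_iff]
  refine ⟨fun h => ?_, fun h => dvd_of_eq (by omega)⟩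
  have := Nat.le_of_dvd i.succ_pos h
  omega

/-- The additive character `x ↦ q ^ (2 x)` of `ℤ / r'`, which records how powers of `K`, with
exponents taken modulo `r'`, commute with `E` and `F`. -/
def qChar (r : ℕ) [NeZero r] : AddChar (ZMod (r' r)) ℂ :=
  AddChar.zmodChar (r' r) (isPrimitiveRoot_q_sq (NeZero.ne r)).pow_eq_one

section

variable (r : ℕ) [NeZero r]

lemma qChar_natCast (n : ℕ) : qChar r n = (q r ^ 2) ^ n := AddChar.zmodChar_apply' _ n

lemma qChar_one : qChar r 1 = q r ^ 2 := by simpa using qChar_natCast r 1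

lemma qChar_natCast_mul (n : ℕ) (x : ZMod (r' r)) : qChar r (n * x) = qChar r x ^ n := by
  rw [← nsmul_eq_mul, AddChar.map_nsmul_eq_pow]

lemma qChar_ne_zero (x : ZMod (r' r)) : qChar r x ≠ 0 := (qChar r).val_isUnit x |>.ne_zero

lemma sum_qChar_mul (x : ZMod (r' r)) :
    ∑ y, qChar r (y * x) = if x = 0 then (r' r : ℂ) else 0 := by
  have h := AddChar.sum_mulShift x (AddChar.zmodChar_primitive_of_primitive_root _
    (isPrimitiveRoot_q_sq (NeZero.ne r)))
  rwa [ZMod.card, Nat.cast_ite, Nat.cast_zero] at h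

end

/-! ### Powers of `K` -/

lemma pow_mul_pow_qcomm {A : Type} [Ring A] [Algebra ℂ A] {x y : A} {ω : ℂ}
    (h : y * x = ω • (x * y)) (m n : ℕ) :
    y ^ m * x ^ n = ω ^ (m * n) • (x ^ n * y ^ m) := by
  induction m with
  | zero => simp
  | succ m ih =>
    rw [pow_succ', mul_assoc, ih, mul_smul_comm, ← mul_assoc, mul_pow_qcomm h, smul_mul_assoc,
      smul_smul, mul_assoc, ← pow_succ', ← pow_add, ← Nat.succ_mul]

/-- The power of `K` with exponent in `ℤ / r'`; it makes sense since `K ^ r' = 1`. -/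
def Kpow (r : ℕ) (x : ZMod (r' r)) : Uq r := K r ^ x.val

lemma Kpow_natCast (r n : ℕ) : Kpow r n = K r ^ n := by
  rw [Kpow, ZMod.val_natCast, ← pow_eq_pow_mod n (K_pow r)]

lemma Kpow_one (r : ℕ) : Kpow r 1 = K r := by simpa using Kpow_natCast r 1

lemma Kpow_zero (r : ℕ) : Kpow r 0 = 1 := by rw [Kpow, ZMod.val_zero, pow_zero]

section

variable (r : ℕ) [NeZero r]

lemma Kpow_add (x y : ZMod (r' r)) : Kpow r (x + y) = Kpow r x * Kpow r y := by
  rw [Kpow, ZMod.val_add, ← pow_eq_pow_mod _ (K_pow r), pow_add, Kpow, Kpow]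

lemma Kpow_neg_one : Kpow r (-1) = Kinv r :=
  calc Kpow r (-1) = Kpow r (-1) * (Kpow r 1 * Kinv r) := by rw [Kpow_one, K_mul_Kinv, mul_one]
    _ = Kinv r := by rw [← mul_assoc, ← Kpow_add, neg_add_cancel, Kpow_zero, one_mul]

lemma Kpow_neg_natCast (n : ℕ) : Kpow r (-n) = Kinv r ^ n := by
  induction n with
  | zero => simp [Kpow_zero]
  | succ n ih => rw [Nat.cast_succ, neg_add, Kpow_add, ih, Kpow_neg_one, pow_succ]

lemma Kpow_mul_E_pow (x : ZMod (r' r)) (m : ℕ) :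
    Kpow r x * E r ^ m = qChar r (m * x) • (E r ^ m * Kpow r x) := by
  rw [Kpow, pow_mul_pow_qcomm (K_mul_E r), ← qChar_natCast, Nat.cast_mul, ZMod.natCast_zmod_val,
    mul_comm]

lemma Kpow_mul_F_pow (x : ZMod (r' r)) (m : ℕ) :
    Kpow r x * F r ^ m = qChar r (-(m * x)) • (F r ^ m * Kpow r x) := by
  rw [Kpow, pow_mul_pow_qcomm (K_mul_F r), inv_pow, ← qChar_natCast, Nat.cast_mul,
    ZMod.natCast_zmod_val, mul_comm, AddChar.map_neg_eq_inv]

lemma Kpow_mul_E (x : ZMod (r' r)) : Kpow r x * E r = qChar r x • (E r * Kpow r x) := by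
  simpa using Kpow_mul_E_pow r x 1

lemma Kpow_mul_F (x : ZMod (r' r)) : Kpow r x * F r = qChar r (-x) • (F r * Kpow r x) := by
  simpa using Kpow_mul_F_pow r x 1

end

/-! ### The basis `E ^ i F ^ j K ^ x` -/

/-- The monomial `E ^ i F ^ j K ^ x` of Poincaré–Birkhoff–Witt type, with `x` in `ℤ / r'`. -/
def pbw (r i j : ℕ) (x : ZMod (r' r)) : Uq r := E r ^ i * F r ^ j * Kpow r x

/-- The part of the `E`-degree filtration spanned by the monomials `E ^ i F ^ j K ^ x` with
`i < n`. -/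
def pbwSpan (r n : ℕ) : Submodule ℂ (Uq r) :=
  Submodule.span ℂ {w | ∃ i j x, i < n ∧ w = pbw r i j x}

section

variable (r : ℕ)

lemma pbw_mem_pbwSpan {i n : ℕ} (hi : i < n) (j : ℕ) (x : ZMod (r' r)) :
    pbw r i j x ∈ pbwSpan r n :=
  Submodule.subset_span ⟨i, j, x, hi, rfl⟩

lemma pbwSpan_mono {m n : ℕ} (h : m ≤ n) : pbwSpan r m ≤ pbwSpan r n :=
  Submodule.span_mono fun _ ⟨i, j, x, hi, hw⟩ => ⟨i, j, x, hi.trans_le h, hw⟩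

lemma map_mem_of_mem_pbwSpan {V : Type*} [AddCommGroup V] [Module ℂ V] {n : ℕ}
    (f : Uq r →ₗ[ℂ] V) {W : Submodule ℂ V} (hf : ∀ i j x, i < n → f (pbw r i j x) ∈ W) {w : Uq r}
    (hw : w ∈ pbwSpan r n) : f w ∈ W :=
  Submodule.span_le (p := W.comap f).2 (by rintro _ ⟨i, j, x, hi, rfl⟩; exact hf i j x hi) hw

lemma E_pow_mul_mem_pbwSpan {n : ℕ} {w : Uq r} (hw : w ∈ pbwSpan r n) (m : ℕ) :
    E r ^ m * w ∈ pbwSpan r (m + n) :=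
  map_mem_of_mem_pbwSpan r (LinearMap.mulLeft ℂ (E r ^ m))
    (fun i j x hi => by
      simpa only [LinearMap.mulLeft_apply, pbw, ← mul_assoc, ← pow_add] using
        pbw_mem_pbwSpan r (Nat.add_lt_add_left hi m) j x) hw

variable [NeZero r]

lemma pbw_mul_Kpow (i j : ℕ) (x y : ZMod (r' r)) :
    pbw r i j x * Kpow r y = pbw r i j (x + y) := by
  rw [pbw, pbw, mul_assoc, ← Kpow_add]

lemma pbw_mul_F (i j : ℕ) (x : ZMod (r' r)) :
    pbw r i j x * F r = qChar r (-x) • pbw r i (j + 1) x := by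
  rw [pbw, pbw, mul_assoc, Kpow_mul_F, mul_smul_comm, pow_succ, mul_assoc, mul_assoc, mul_assoc]

lemma mul_Kpow_mem_pbwSpan {n : ℕ} {w : Uq r} (hw : w ∈ pbwSpan r n) (y : ZMod (r' r)) :
    w * Kpow r y ∈ pbwSpan r n :=
  map_mem_of_mem_pbwSpan r (LinearMap.mulRight ℂ (Kpow r y))
    (fun i j x hi => by
      simpa only [LinearMap.mulRight_apply, pbw_mul_Kpow] using pbw_mem_pbwSpan r hi j (x + y)) hw

lemma mul_F_mem_pbwSpan {n : ℕ} {w : Uq r} (hw : w ∈ pbwSpan r n) : w * F r ∈ pbwSpan r n :=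
  map_mem_of_mem_pbwSpan r (LinearMap.mulRight ℂ (F r))
    (fun i j x hi => by
      simpa only [LinearMap.mulRight_apply, pbw_mul_F] using
        Submodule.smul_mem _ _ (pbw_mem_pbwSpan r hi (j + 1) x)) hw

lemma F_pow_mul_E_sub_mem_pbwSpan (j : ℕ) : F r ^ j * E r - E r * F r ^ j ∈ pbwSpan r 1 := by
  induction j with
  | zero => simp
  | succ j ih =>
    have hcomm : F r ^ j * (F r * E r - E r * F r) ∈ pbwSpan r 1 := by
      have h : F r ^ j * (F r * E r - E r * F r) =
          (q r - (q r)⁻¹)⁻¹ • (pbw r 0 j (-1) - pbw r 0 j 1) := by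
        rw [← neg_sub (E r * F r), E_F_comm, ← smul_neg, neg_sub, mul_smul_comm, mul_sub]
        simp only [pbw, pow_zero, one_mul, Kpow_neg_one, Kpow_one]
      rw [h]
      exact Submodule.smul_mem _ _ (Submodule.sub_mem _ (pbw_mem_pbwSpan r one_pos j _)
        (pbw_mem_pbwSpan r one_pos j _))
    have hsplit : F r ^ (j + 1) * E r - E r * F r ^ (j + 1) =
        F r ^ j * (F r * E r - E r * F r) + (F r ^ j * E r - E r * F r ^ j) * F r := by
      rw [pow_succ]; noncomm_ring
    rw [hsplit]
    exact Submodule.add_mem _ hcomm (mul_F_mem_pbwSpan r ih)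

lemma mul_E_mem_pbwSpan {n : ℕ} {w : Uq r} (hw : w ∈ pbwSpan r n) :
    w * E r ∈ pbwSpan r (n + 1) := by
  refine map_mem_of_mem_pbwSpan r (LinearMap.mulRight ℂ (E r)) (fun i j x hi => ?_) hw
  have h : pbw r i j x * E r =
      qChar r x • (E r ^ i * (F r ^ j * E r - E r * F r ^ j) * Kpow r x + pbw r (i + 1) j x) := by
    rw [pbw, pbw, mul_assoc, Kpow_mul_E, mul_smul_comm, pow_succ]
    noncomm_ring
  rw [LinearMap.mulRight_apply, h]
  refine Submodule.smul_mem _ _ (Submodule.add_mem _ (mul_Kpow_mem_pbwSpan r ?_ x)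
    (pbw_mem_pbwSpan r (by omega) j x))
  exact pbwSpan_mono r (by omega) (E_pow_mul_mem_pbwSpan r (F_pow_mul_E_sub_mem_pbwSpan r j) i)

lemma F_pow_mul_E_pow_sub_mem_pbwSpan (m n : ℕ) :
    F r ^ m * E r ^ n - E r ^ n * F r ^ m ∈ pbwSpan r n := by
  induction n with
  | zero => simp
  | succ n ih =>
    have hsplit : F r ^ m * E r ^ (n + 1) - E r ^ (n + 1) * F r ^ m =
        (F r ^ m * E r ^ n - E r ^ n * F r ^ m) * E r +
          E r ^ n * (F r ^ m * E r - E r * F r ^ m) := by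
      rw [pow_succ]; noncomm_ring
    rw [hsplit]
    exact Submodule.add_mem _ (mul_E_mem_pbwSpan r ih)
      (E_pow_mul_mem_pbwSpan r (F_pow_mul_E_sub_mem_pbwSpan r m) n)

lemma pbwSpan_eq_top : pbwSpan r (r' r) = ⊤ := by
  have hsucc : pbwSpan r (r' r + 1) ≤ pbwSpan r (r' r) := by
    refine Submodule.span_le.2 ?_
    rintro _ ⟨i, j, x, hi, rfl⟩
    rcases (Nat.lt_succ_iff.1 hi).eq_or_lt with rfl | hi
    · simp [pbw, E_pow]
    · exact pbw_mem_pbwSpan r hi j x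
  have hmul (x : Uq r) : ∀ w ∈ pbwSpan r (r' r), w * x ∈ pbwSpan r (r' r) := by
    induction x using induction_on with
    | hc c =>
      intro w hw
      simpa only [← Algebra.commutes c w, ← Algebra.smul_def] using Submodule.smul_mem _ c hw
    | hK => exact fun w hw => Kpow_one r ▸ mul_Kpow_mem_pbwSpan r hw 1
    | hKinv => exact fun w hw => Kpow_neg_one r ▸ mul_Kpow_mem_pbwSpan r hw (-1)
    | hE => exact fun w hw => hsucc (mul_E_mem_pbwSpan r hw)
    | hF => exact fun w hw => mul_F_mem_pbwSpan r hw
    | hadd a b ha hb => exact fun w hw => mul_add w a b ▸ Submodule.add_mem _ (ha w hw) (hb w hw)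
    | hmul a b ha hb => exact fun w hw => mul_assoc w a b ▸ hb _ (ha w hw)
  have hone : (1 : Uq r) ∈ pbwSpan r (r' r) := by
    simpa [pbw, Kpow_zero] using pbw_mem_pbwSpan r (NeZero.pos (r' r)) 0 0
  exact Submodule.eq_top_iff'.2 fun x => one_mul x ▸ hmul x 1 hone

lemma linearMap_ext_pbw {V : Type*} [AddCommGroup V] [Module ℂ V] {f g : Uq r →ₗ[ℂ] V}
    (h : ∀ i j x, i < r' r → j < r' r → f (pbw r i j x) = g (pbw r i j x)) : f = g := by
  ext w
  have hw : w ∈ pbwSpan r (r' r) := pbwSpan_eq_top r ▸ Submodule.mem_top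
  refine sub_eq_zero.1 ((Submodule.mem_bot ℂ).1
    (map_mem_of_mem_pbwSpan r (f - g) (W := ⊥) (fun i j x hi => ?_) hw))
  rw [Submodule.mem_bot, LinearMap.sub_apply, sub_eq_zero]
  rcases lt_or_ge j (r' r) with hj | hj
  · exact h i j x hi hj
  · rw [pbw, pow_eq_zero_of_le hj (F_pow r), mul_zero, zero_mul, map_zero, map_zero]

end

/-! ### The coproduct of a monomial -/

section

variable (r : ℕ)

lemma comulHom_Kpow (x : ZMod (r' r)) : comulHom r (Kpow r x) = Kpow r x ⊗ₜ Kpow r x := by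
  simp [Kpow, comulHom, Algebra.TensorProduct.tmul_pow]

lemma comulHom_E_pow (a : ℕ) :
    comulHom r (E r ^ a) = ∑ p ∈ Finset.HasAntidiagonal.antidiagonal a,
      gauss (q r ^ 2) p.1 p.2 • ((E r ^ p.2) ⊗ₜ[ℂ] (E r ^ p.1 * Kpow r p.2)) := by
  have h : (E r ⊗ₜ[ℂ] K r) * (1 ⊗ₜ E r) = q r ^ 2 • ((1 ⊗ₜ E r) * (E r ⊗ₜ[ℂ] K r)) := by
    simp [K_mul_E]
  rw [map_pow, comulHom, lift_E, add_comm, add_pow_qcomm h]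
  simp [Algebra.TensorProduct.tmul_pow, Kpow_natCast]

variable [NeZero r]

lemma comulHom_F_pow (b : ℕ) :
    comulHom r (F r ^ b) = ∑ s ∈ Finset.HasAntidiagonal.antidiagonal b,
      gauss (q r ^ 2) s.1 s.2 • ((F r ^ s.1 * Kpow r (-s.2)) ⊗ₜ[ℂ] (F r ^ s.2)) := by
  have h : (Kinv r ⊗ₜ[ℂ] F r) * (F r ⊗ₜ 1) = q r ^ 2 • ((F r ⊗ₜ 1) * (Kinv r ⊗ₜ[ℂ] F r)) := by
    simp [Kinv_mul_F, TensorProduct.smul_tmul']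
  rw [map_pow, comulHom, lift_F, add_pow_qcomm h]
  simp [Algebra.TensorProduct.tmul_pow, Kpow_neg_natCast]

lemma comulHom_pbw (a b : ℕ) (x : ZMod (r' r)) :
    comulHom r (pbw r a b x) =
      ∑ t ∈ Finset.HasAntidiagonal.antidiagonal a ×ˢ Finset.HasAntidiagonal.antidiagonal b,
        (gauss (q r ^ 2) t.1.1 t.1.2 * gauss (q r ^ 2) t.2.1 t.2.2 *
            qChar r (-(t.2.2 * t.1.2))) •
          (pbw r t.1.2 t.2.1 (x - t.2.2) ⊗ₜ[ℂ] pbw r t.1.1 t.2.2 (t.1.2 + x)) := by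
  rw [pbw, map_mul, map_mul, comulHom_E_pow, comulHom_F_pow, comulHom_Kpow,
    Finset.sum_mul_sum, ← Finset.sum_product', Finset.sum_mul]
  refine Finset.sum_congr rfl fun t _ => ?_
  have hleft : E r ^ t.1.2 * (F r ^ t.2.1 * Kpow r (-t.2.2)) * Kpow r x =
      pbw r t.1.2 t.2.1 (x - t.2.2) := by
    rw [pbw, sub_eq_neg_add, Kpow_add]; noncomm_ring
  have hright : E r ^ t.1.1 * Kpow r t.1.2 * F r ^ t.2.2 * Kpow r x =
      qChar r (-(t.2.2 * t.1.2)) • pbw r t.1.1 t.2.2 (t.1.2 + x) := by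
    rw [mul_assoc (E r ^ _), Kpow_mul_F_pow, pbw, Kpow_add, mul_smul_comm, smul_mul_assoc]
    noncomm_ring
  rw [smul_mul_smul_comm, smul_mul_assoc, Algebra.TensorProduct.tmul_mul_tmul,
    Algebra.TensorProduct.tmul_mul_tmul, hleft, hright, TensorProduct.tmul_smul, smul_smul]

end

/-! ### The left integral -/

/-- The value of the preferred integral on the top monomial `E ^ (r' - 1) F ^ (r' - 1) K⁻¹`. -/
def topValue (r : ℕ) : ℂ :=
  (Real.sqrt (r'' r) : ℂ) * qFact r (r' r - 1) / qBrace r 1 ^ (r' r - 1)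

section

variable {r : ℕ} [NeZero r] {lam : Uq r →ₗ[ℂ] ℂ}

lemma isPreferred_iff_apply_pbw :
    IsPreferred r lam ↔ ∀ i j x, i < r' r → j < r' r →
      lam (pbw r i j x) = if i = r' r - 1 ∧ j = r' r - 1 ∧ x = -1 then topValue r else 0 := by
  constructor
  · intro h i j x hi hj
    simp only [pbw, Kpow, h i j x.val hi hj x.val_lt, ← natCast_eq_neg_one_iff x.val_lt,
      ZMod.natCast_zmod_val, topValue]
  · intro h a b c ha hb hc
    rw [← Kpow_natCast, ← pbw, h a b c ha hb]
    simp only [natCast_eq_neg_one_iff hc, topValue]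

lemma IsPreferred.apply_pbw (h : IsPreferred r lam) {i j : ℕ} (hi : i < r' r) (hj : j < r' r)
    (x : ZMod (r' r)) :
    lam (pbw r i j x) = if i = r' r - 1 ∧ j = r' r - 1 ∧ x = -1 then topValue r else 0 :=
  isPreferred_iff_apply_pbw.1 h i j x hi hj

lemma IsPreferred.unique (h : IsPreferred r lam) {mu : Uq r →ₗ[ℂ] ℂ} (hmu : IsPreferred r mu) :
    lam = mu :=
  linearMap_ext_pbw r fun i j x hi hj => by rw [h.apply_pbw hi hj, hmu.apply_pbw hi hj]

theorem IsPreferred.isLeftIntegral (h : IsPreferred r lam) : IsLeftIntegral lam := by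
  let partialEval : Uq r →ₗ[ℂ] Uq r :=
    (TensorProduct.rid ℂ (Uq r)).toLinearMap ∘ₗ lam.lTensor (Uq r) ∘ₗ (comulHom r).toLinearMap
  suffices H : partialEval = lam.smulRight 1 from fun x => LinearMap.congr_fun H x
  refine linearMap_ext_pbw r fun i j x hi hj => ?_
  have hsum : partialEval (pbw r i j x) =
      ∑ t ∈ Finset.HasAntidiagonal.antidiagonal i ×ˢ Finset.HasAntidiagonal.antidiagonal j,
        (gauss (q r ^ 2) t.1.1 t.1.2 * gauss (q r ^ 2) t.2.1 t.2.2 *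
            qChar r (-(t.2.2 * t.1.2))) •
          lam (pbw r t.1.1 t.2.2 (t.1.2 + x)) • pbw r t.1.2 t.2.1 (x - t.2.2) := by
    simp [partialEval, comulHom_pbw]
  rw [hsum, LinearMap.smulRight_apply, Finset.sum_eq_single ((i, 0), (0, j))]
  · simp only [gauss_zero_right, gauss_zero_left, Nat.cast_zero, mul_zero, neg_zero,
      AddChar.map_zero_eq_one, mul_one, one_smul, zero_add, h.apply_pbw hi hj]
    split_ifs with hx
    · obtain ⟨-, rfl, rfl⟩ := hx
      rw [Nat.cast_pred (NeZero.pos _), CharP.cast_eq_zero]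
      simp [pbw, Kpow_zero]
    · simp only [zero_smul]
  · rintro ⟨⟨i₁, i₂⟩, ⟨j₁, j₂⟩⟩ ht hne
    simp only [Finset.mem_product, Finset.HasAntidiagonal.mem_antidiagonal, ne_eq,
      Prod.mk.injEq] at ht hne
    dsimp only
    rw [h.apply_pbw (by omega) (by omega), if_neg (by omega), zero_smul, smul_zero]
  · simp

end

/-! ### Weighted shifts -/

/-- The operator `φ ↦ (b ↦ w b * φ (b + d))` on functions on `G`: multiplication by the weight `w`
after translation by `d`. -/
def weightedShift {G R : Type*} [Add G] [CommSemiring R] (d : G) (w : G → R) :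
    Module.End R (G → R) :=
  LinearMap.mulLeft R w ∘ₗ LinearMap.funLeft R R (· + d)

lemma weightedShift_apply {G R : Type*} [Add G] [CommSemiring R] (d : G) (w φ : G → R) (b : G) :
    weightedShift d w φ b = w b * φ (b + d) := rfl

lemma weightedShift_zero_mul_eq_one {G R : Type*} [AddZeroClass G] [CommSemiring R] {u v : G → R}
    (h : ∀ b, u b * v b = 1) : weightedShift 0 u * weightedShift 0 v = 1 := by
  refine LinearMap.ext fun φ => funext fun b => ?_
  simp only [Module.End.mul_apply, Module.End.one_apply, weightedShift_apply, add_zero,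
    ← mul_assoc, h, one_mul]

lemma weightedShift_pow_apply {G R : Type*} [AddMonoid G] [CommSemiring R] (d : G) (w : G → R)
    (n : ℕ) (φ : G → R) (b : G) :
    (weightedShift d w ^ n) φ b = (∏ i ∈ Finset.range n, w (b + i • d)) * φ (b + n • d) := by
  induction n generalizing φ with
  | zero => simp
  | succ n ih =>
    rw [pow_succ, Module.End.mul_apply, ih, weightedShift_apply, Finset.prod_range_succ, mul_assoc,
      add_assoc, succ_nsmul]

lemma weightedShift_pow_eq_zero {R : Type*} [CommSemiring R] {N : ℕ} [NeZero N] {d b₀ : ZMod N}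
    {w : ZMod N → R} (hd : IsUnit d) (hw : w b₀ = 0) : weightedShift d w ^ N = 0 := by
  refine LinearMap.ext fun φ => funext fun b => ?_
  obtain ⟨e, he⟩ := hd.exists_left_inv
  rw [weightedShift_pow_apply, Finset.prod_eq_zero (i := ((b₀ - b) * e).val)
    (Finset.mem_range.2 (ZMod.val_lt _)), zero_mul]
  · rfl
  · rw [nsmul_eq_mul, ZMod.natCast_zmod_val, mul_assoc, he, mul_one, add_sub_cancel, hw]

/-! ### Baby Verma modules -/

lemma IsRep.swap {r : ℕ} {A : Type} [Ring A] [Algebra ℂ A] {k l e f : A} (h : IsRep r k l e f) :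
    IsRep r l k f e where
  kl := h.lk
  lk := h.kl
  ke := by simpa using congrArg (lift r h) (Kinv_mul_F r)
  kf := by simpa using congrArg (lift r h) (Kinv_mul_E r)
  ef := by rw [← neg_sub, h.ef, ← smul_neg, neg_sub]
  kp := by simpa using congrArg (lift r h) (Kinv_pow r)
  ep := h.fp
  fp := h.ep

section

variable (r : ℕ) [NeZero r]

/-- The scalar by which `E` maps `F ^ b v` to `F ^ (b - 1) v`, where `v` is a highest weight vector
of weight `q ^ (2 y)`. -/
def vermaCoeff (y b : ZMod (r' r)) : ℂ :=
  (1 - qChar r (-b)) * (qChar r y * q r - qChar r (b - y) * (q r)⁻¹) * (q r - (q r)⁻¹)⁻¹ ^ 2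

lemma vermaCoeff_zero (y : ZMod (r' r)) : vermaCoeff r y 0 = 0 := by simp [vermaCoeff]

lemma vermaCoeff_add_one_sub (y b : ZMod (r' r)) :
    vermaCoeff r y (b + 1) - vermaCoeff r y b =
      (q r - (q r)⁻¹)⁻¹ * (qChar r (y - b) - qChar r (b - y)) := by
  have hq := q_ne_zero r
  have hb := qChar_ne_zero r b
  have hy := qChar_ne_zero r y
  have hinv : (q r - (q r)⁻¹) * (q r - (q r)⁻¹)⁻¹ ^ 2 = (q r - (q r)⁻¹)⁻¹ := by
    rcases eq_or_ne (q r - (q r)⁻¹) 0 with h | _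
    · simp [h]
    · field_simp
  rw [← hinv]
  simp only [vermaCoeff, neg_add, sub_eq_add_neg, AddChar.map_add_eq_mul, AddChar.map_neg_eq_inv,
    qChar_one]
  generalize (q r + -(q r)⁻¹)⁻¹ = t
  field_simp
  ring

/-- The baby Verma module of highest weight `q ^ (2 y)`, realized on functions on `ℤ / r'`: the
indicator function of `b` plays the role of `F ^ b v`, where `v` is the highest weight vector. -/
lemma isRep_babyVerma (y : ZMod (r' r)) :
    IsRep r (A := Module.End ℂ (ZMod (r' r) → ℂ))
      (weightedShift 0 fun b => qChar r (y - b)) (weightedShift 0 fun b => qChar r (b - y))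
      (weightedShift 1 fun b => vermaCoeff r y (b + 1))
      (weightedShift (-1) fun b => if b = 0 then 0 else 1) where
  kl := weightedShift_zero_mul_eq_one fun b => by
    rw [← AddChar.map_add_eq_mul, sub_add_sub_cancel, sub_self, AddChar.map_zero_eq_one]
  lk := weightedShift_zero_mul_eq_one fun b => by
    rw [← AddChar.map_add_eq_mul, sub_add_sub_cancel, sub_self, AddChar.map_zero_eq_one]
  ke := by
    refine LinearMap.ext fun φ => funext fun b => ?_
    have h : qChar r (y - b) = q r ^ 2 * qChar r (y - (b + 1)) := by
      rw [← qChar_one, ← AddChar.map_add_eq_mul]; congr 1; ring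
    simp only [Module.End.mul_apply, LinearMap.smul_apply, Pi.smul_apply, smul_eq_mul,
      weightedShift_apply, add_zero, h]
    ring
  kf := by
    refine LinearMap.ext fun φ => funext fun b => ?_
    have h : qChar r (y - b) = (q r ^ 2)⁻¹ * qChar r (y - (b + -1)) := by
      rw [← qChar_one, ← AddChar.map_neg_eq_inv, ← AddChar.map_add_eq_mul]; congr 1; ring
    simp only [Module.End.mul_apply, LinearMap.smul_apply, Pi.smul_apply, smul_eq_mul,
      weightedShift_apply, add_zero, h]
    ring
  ef := by
    refine LinearMap.ext fun φ => funext fun b => ?_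
    have h (b : ZMod (r' r)) : vermaCoeff r y b * (if b = 0 then 0 else 1) = vermaCoeff r y b := by
      split_ifs with hb
      · rw [hb, vermaCoeff_zero, zero_mul]
      · rw [mul_one]
    simp only [LinearMap.sub_apply, Module.End.mul_apply, LinearMap.smul_apply, Pi.sub_apply,
      Pi.smul_apply, smul_eq_mul, weightedShift_apply, add_neg_cancel_right, neg_add_cancel_right,
      add_zero]
    linear_combination φ b * (h (b + 1) - h b + vermaCoeff_add_one_sub r y b)
  kp := by
    refine LinearMap.ext fun φ => funext fun b => ?_
    simp only [weightedShift_pow_apply, smul_zero, add_zero, Finset.prod_const, Finset.card_range,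
      ← qChar_natCast_mul, ZMod.natCast_self, zero_mul, AddChar.map_zero_eq_one, one_mul,
      Module.End.one_apply]
  ep := weightedShift_pow_eq_zero (b₀ := -1) isUnit_one (by rw [neg_add_cancel, vermaCoeff_zero])
  fp := weightedShift_pow_eq_zero (b₀ := 0) isUnit_one.neg (if_pos rfl)

end

/-! ### Existence of the integral -/

/-- The coefficient of the last basis vector in `x v`, where `v` is the first basis vector, for a
representation of `u_q sl₂` on functions on `ℤ / r'`. -/
def lastCoeff {r : ℕ} {k l e f : Module.End ℂ (ZMod (r' r) → ℂ)} (h : IsRep r k l e f) :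
    Uq r →ₗ[ℂ] ℂ :=
  LinearMap.proj (-1) ∘ₗ LinearMap.applyₗ (Pi.single 0 1) ∘ₗ (lift r h).toLinearMap

lemma lastCoeff_apply {r : ℕ} {k l e f : Module.End ℂ (ZMod (r' r) → ℂ)} (h : IsRep r k l e f)
    (x : Uq r) : lastCoeff h x = lift r h x (Pi.single 0 1) (-1) := rfl

lemma weightedShift_zero_pow_single {G R : Type*} [AddMonoid G] [DecidableEq G] [CommSemiring R]
    (w : G → R) (n : ℕ) :
    (weightedShift 0 w ^ n) (Pi.single 0 1) = w 0 ^ n • Pi.single 0 1 := by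
  ext b
  rcases eq_or_ne b 0 with rfl | hb
  · simp [weightedShift_pow_apply]
  · simp [weightedShift_pow_apply, hb]

lemma babyVerma_F_pow_single_neg_one {N n : ℕ} (hn : n < N) :
    ((weightedShift (-1) fun b : ZMod N => if b = 0 then (0 : ℂ) else 1) ^ n)
      (Pi.single 0 1) (-1) = if n = N - 1 then 1 else 0 := by
  have hzero {i : ℕ} (hi : i < N) : (-1 + i • -1 : ZMod N) = 0 ↔ i = N - 1 := by
    rw [← natCast_eq_neg_one_iff hi, nsmul_eq_mul, mul_neg_one, add_neg_eq_zero, eq_comm]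
  have hprod : ∏ i ∈ Finset.range n, (if (-1 + i • -1 : ZMod N) = 0 then (0 : ℂ) else 1) = 1 :=
    Finset.prod_eq_one fun i hi => by
      rw [Finset.mem_range] at hi
      rw [if_neg fun h => ?_]
      have := (hzero (hi.trans hn)).1 h
      omega
  rw [weightedShift_pow_apply, hprod, one_mul, Pi.single_apply]
  exact if_congr (hzero hn) rfl rfl

section

variable (r : ℕ) [NeZero r]

lemma babyVerma_E_pow_single (y : ZMod (r' r)) (n : ℕ) :
    ((weightedShift 1 fun b => vermaCoeff r y (b + 1)) ^ n) (Pi.single 0 1) =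
      if n = 0 then Pi.single 0 1 else 0 := by
  cases n with
  | zero => simp
  | succ n =>
    rw [pow_succ, Module.End.mul_apply, if_neg n.succ_ne_zero]
    suffices h : weightedShift 1 (fun b => vermaCoeff r y (b + 1)) (Pi.single 0 1) = 0 by
      rw [h, map_zero]
    ext b
    rcases eq_or_ne (b + 1) 0 with hb | hb
    · rw [weightedShift_apply, hb, vermaCoeff_zero, zero_mul, Pi.zero_apply]
    · rw [weightedShift_apply, Pi.single_eq_of_ne hb, mul_zero, Pi.zero_apply]

lemma babyVerma_E_pow_apply_neg_one (y : ZMod (r' r)) (n : ℕ) (φ : ZMod (r' r) → ℂ) :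
    ((weightedShift 1 fun b => vermaCoeff r y (b + 1)) ^ n) φ (-1) =
      if n = 0 then φ (-1) else 0 := by
  cases n with
  | zero => simp
  | succ n =>
    rw [pow_succ', Module.End.mul_apply, weightedShift_apply, neg_add_cancel, vermaCoeff_zero,
      zero_mul, if_neg n.succ_ne_zero]

/-- The matrix coefficient of the baby Verma module of highest weight `q ^ (2 y)` which detects
`F ^ (r' - 1)`. -/
def highestForm (y : ZMod (r' r)) : Uq r →ₗ[ℂ] ℂ := lastCoeff (isRep_babyVerma r y)

/-- The matrix coefficient which detects `E ^ (r' - 1)`, of the module obtained from a baby Verma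
module by exchanging `E` with `F` and `K` with `K⁻¹`. -/
def lowestForm : Uq r →ₗ[ℂ] ℂ := lastCoeff (isRep_babyVerma r 0).swap

lemma highestForm_pbw (y : ZMod (r' r)) (i : ℕ) {j : ℕ} (hj : j < r' r) (x : ZMod (r' r)) :
    highestForm r y (pbw r i j x) = if i = 0 ∧ j = r' r - 1 then qChar r (y * x) else 0 := by
  have hK : lift r (isRep_babyVerma r y) (Kpow r x) (Pi.single 0 1) =
      qChar r (y * x) • Pi.single 0 1 := by
    rw [Kpow, map_pow, lift_K, weightedShift_zero_pow_single, sub_zero, ← qChar_natCast_mul,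
      ZMod.natCast_zmod_val, mul_comm]
  rw [highestForm, lastCoeff_apply, pbw, map_mul, map_mul, Module.End.mul_apply, hK, map_smul,
    Module.End.mul_apply, map_pow, lift_E, map_pow, lift_F, Pi.smul_apply,
    babyVerma_E_pow_apply_neg_one, babyVerma_F_pow_single_neg_one hj]
  split_ifs <;> simp_all

lemma lowestForm_pbw {i : ℕ} (hi : i < r' r) (j : ℕ) (x : ZMod (r' r)) :
    lowestForm r (pbw r i j x) = if i = r' r - 1 ∧ j = 0 then 1 else 0 := by
  have hK : lift r (isRep_babyVerma r 0).swap (Kpow r x) (Pi.single 0 1) = Pi.single 0 1 := by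
    rw [Kpow, map_pow, lift_K, weightedShift_zero_pow_single, sub_zero, AddChar.map_zero_eq_one,
      one_pow, one_smul]
  rw [lowestForm, lastCoeff_apply, pbw, map_mul, map_mul, Module.End.mul_apply, hK,
    Module.End.mul_apply, map_pow, lift_E, map_pow, lift_F, babyVerma_E_pow_single]
  rcases eq_or_ne j 0 with rfl | hj
  · simp only [if_true, and_true, babyVerma_F_pow_single_neg_one hi]
  · simp only [hj, if_false, map_zero, Pi.zero_apply, and_false]

/-- The matrix coefficient `lowestForm ⊗ highestForm` of a tensor product of modules. -/
def weightForm (y : ZMod (r' r)) : Uq r →ₗ[ℂ] ℂ :=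
  LinearMap.mul' ℂ ℂ ∘ₗ TensorProduct.map (lowestForm r) (highestForm r y) ∘ₗ
    (comulHom r).toLinearMap

lemma weightForm_pbw (y : ZMod (r' r)) {i j : ℕ} (hi : i < r' r) (hj : j < r' r)
    (x : ZMod (r' r)) :
    weightForm r y (pbw r i j x) =
      if i = r' r - 1 ∧ j = r' r - 1 then qChar r (y * (x - 1) - 1) else 0 := by
  have hsum : weightForm r y (pbw r i j x) =
      ∑ t ∈ Finset.HasAntidiagonal.antidiagonal i ×ˢ Finset.HasAntidiagonal.antidiagonal j,
        (gauss (q r ^ 2) t.1.1 t.1.2 * gauss (q r ^ 2) t.2.1 t.2.2 *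
            qChar r (-(t.2.2 * t.1.2))) *
          (lowestForm r (pbw r t.1.2 t.2.1 (x - t.2.2)) *
            highestForm r y (pbw r t.1.1 t.2.2 (t.1.2 + x))) := by
    simp [weightForm, comulHom_pbw]
  rw [hsum, Finset.sum_eq_single ((0, i), (0, j))]
  · simp only [lowestForm_pbw r hi, highestForm_pbw r y _ hj, gauss_zero_left, and_true, true_and,
      one_mul]
    by_cases hij : i = r' r - 1 ∧ j = r' r - 1
    · rw [if_pos hij.1, if_pos hij.2, if_pos hij, (natCast_eq_neg_one_iff hi).2 hij.1,
        (natCast_eq_neg_one_iff hj).2 hij.2, one_mul, ← AddChar.map_add_eq_mul]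
      congr 1
      ring
    · rw [if_neg hij]
      rcases not_and_or.1 hij with h | h <;> simp [h]
  · rintro ⟨⟨i₁, i₂⟩, ⟨j₁, j₂⟩⟩ ht hne
    simp only [Finset.mem_product, Finset.HasAntidiagonal.mem_antidiagonal, ne_eq,
      Prod.mk.injEq] at ht hne
    dsimp only
    rw [lowestForm_pbw r (by omega), highestForm_pbw r y _ (by omega)]
    split_ifs <;> first | omega | simp
  · simp

/-- The form with `E ^ (r' - 1) F ^ (r' - 1) K⁻¹ ↦ topValue r`, obtained from the forms
`weightForm r y` by Fourier inversion in the weight `y`. -/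
def integral : Uq r →ₗ[ℂ] ℂ :=
  (topValue r / r' r) • ∑ y, qChar r (2 * y + 1) • weightForm r y

lemma isPreferred_integral : IsPreferred r (integral r) := by
  refine isPreferred_iff_apply_pbw.2 fun i j x hi hj => ?_
  have happly : integral r (pbw r i j x) = topValue r / r' r * ∑ y, qChar r (2 * y + 1) *
      (if i = r' r - 1 ∧ j = r' r - 1 then qChar r (y * (x - 1) - 1) else 0) := by
    simp only [integral, LinearMap.smul_apply, LinearMap.sum_apply, smul_eq_mul,
      weightForm_pbw r _ hi hj]
  have hchar (y : ZMod (r' r)) :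
      qChar r (2 * y + 1) * qChar r (y * (x - 1) - 1) = qChar r (y * (x + 1)) := by
    rw [← AddChar.map_add_eq_mul]; congr 1; ring
  simp only [happly, ← and_assoc]
  by_cases hij : i = r' r - 1 ∧ j = r' r - 1
  · simp only [hij, and_self, if_true, true_and, hchar, sum_qChar_mul, mul_ite, mul_zero,
      ← eq_neg_iff_add_eq_zero, div_mul_cancel₀ _ (NeZero.ne (r' r : ℂ))]
  · simp only [hij, if_false, mul_zero, Finset.sum_const_zero, false_and]

end

/-! ### The integral of the ribbon element -/

section

variable (r : ℕ)

lemma K_mul_F_pow (a : ℕ) :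
    (K r * F r) ^ a = (q r)⁻¹ ^ (a * (a + 1)) • (F r ^ a * K r ^ a) := by
  induction a with
  | zero => simp
  | succ a ih =>
    have hcomm : K r ^ (a + 1) * F r = ((q r ^ 2)⁻¹) ^ (a + 1) • (F r * K r ^ (a + 1)) := by
      simpa using pow_mul_pow_qcomm (K_mul_F r) (a + 1) 1
    rw [pow_succ, ih, smul_mul_assoc, mul_assoc, ← mul_assoc (K r ^ a), ← pow_succ, hcomm,
      mul_smul_comm, smul_smul, ← mul_assoc, ← pow_succ, ← inv_pow, ← pow_mul, ← pow_add]
    congr 2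
    ring

lemma antipodeLin_pow (x : Uq r) (n : ℕ) : antipodeLin r (x ^ n) = antipodeLin r x ^ n := by
  simp [antipodeLin]

variable [NeZero r]

lemma drinfeldElement_RMatrix : drinfeldElement (RMatrix r) =
    (1 / (r' r : ℂ)) •
    ∑ a ∈ Finset.range (r' r), ∑ b ∈ Finset.range (r' r), ∑ c ∈ Finset.range (r' r),
      (qBrace r 1 ^ a / qFact r a * q r ^ (((a * (a - 1) / 2 : ℕ) : ℤ) - 2 * b * c)) •
        ((-(K r * F r)) ^ a * Kinv r ^ c * (K r ^ b * E r ^ a)) := by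
  have hS (x : Uq r) : HopfAlgebra.antipode ℂ x = antipodeLin r x := rfl
  simp only [drinfeldElement, RMatrix, map_smul, map_sum, TensorProduct.comm_tmul,
    LinearMap.rTensor_tmul, LinearMap.mul'_apply, hS, antipodeLin_mul, antipodeLin_pow,
    antipodeLin_K, antipodeLin_F]

lemma ribbonTerm_eq_smul (a b c : ℕ) :
    (-(K r * F r)) ^ a * Kinv r ^ c * (K r ^ b * E r ^ a) * Kinv r =
      ((-1) ^ a * (q r)⁻¹ ^ (a * (a + 1)) * qChar r (a * (a - c + b))) •
        (F r ^ a * E r ^ a * Kpow r (a - c + b - 1)) := by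
  have hneg : (-(K r * F r)) ^ a = ((-1 : ℂ) ^ a) • (K r * F r) ^ a := by
    rw [← neg_one_smul ℂ, smul_pow]
  calc (-(K r * F r)) ^ a * Kinv r ^ c * (K r ^ b * E r ^ a) * Kinv r
      = ((-1) ^ a * (q r)⁻¹ ^ (a * (a + 1))) •
          (F r ^ a * (Kpow r (a - c + b) * E r ^ a) * Kpow r (-1)) := by
        rw [hneg, K_mul_F_pow, smul_smul, sub_eq_add_neg, Kpow_add, Kpow_add, Kpow_neg_natCast,
          Kpow_natCast, Kpow_natCast, Kpow_neg_one]
        simp only [smul_mul_assoc, mul_assoc]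
    _ = _ := by
        rw [Kpow_mul_E_pow, mul_smul_comm, smul_mul_assoc, smul_smul, sub_eq_add_neg _ (1 : ZMod _),
          Kpow_add _ _ (-1)]
        simp only [mul_assoc]

end

section

variable {r : ℕ}

lemma one_lt_r' (hr : 2 < r) : 1 < r' r := by
  have hgcd : Nat.gcd r 2 ≤ 2 := Nat.gcd_le_right r two_pos
  exact (Nat.lt_div_iff_mul_lt_of_dvd (Nat.gcd_pos_of_pos_right r two_pos).ne'
    (Nat.gcd_dvd_left r 2)).2 (by omega)

lemma qBrace_ne_zero {k : ℕ} (hk : k ≠ 0) (hkr : k < r' r) : qBrace r k ≠ 0 := by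
  have hsq : (q r ^ 2) ^ k ≠ 1 :=
    (isPrimitiveRoot_of_r'_ne_zero (by omega)).pow_ne_one_of_pos_of_lt hk hkr
  have hq : q r ^ k ≠ 0 := pow_ne_zero k (q_ne_zero r)
  rw [qBrace, zpow_neg, zpow_natCast, sub_ne_zero, ne_eq, ← mul_eq_one_iff_eq_inv₀ hq]
  rwa [← pow_two, ← pow_mul, mul_comm, pow_mul]

lemma qFact_ne_zero {n : ℕ} (hn : n < r' r) : qFact r n ≠ 0 :=
  Finset.prod_ne_zero_iff.2 fun k hk => by
    have hk' := Finset.mem_range.1 hk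
    have hone : qBrace r 1 ≠ 0 := mod_cast qBrace_ne_zero (k := 1) one_ne_zero (by omega)
    exact div_ne_zero (mod_cast qBrace_ne_zero k.succ_ne_zero (by omega)) hone

variable [NeZero r]

lemma neg_one_pow_mul_q_pow :
    (-1 : ℂ) ^ (r' r - 1) * (q r)⁻¹ ^ ((r' r - 1) * (r' r - 1 + 1)) = 1 := by
  have hroot := Complex.isPrimitiveRoot_exp r (NeZero.ne r)
  rw [Nat.sub_add_cancel (NeZero.pos (r' r)), mul_comm (r' r - 1), pow_mul, ← mul_pow]
  rcases Nat.even_or_odd r with he | ho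
  · have hr' : r = r' r * 2 := by
      rw [r', Nat.gcd_eq_right he.two_dvd, Nat.div_mul_cancel he.two_dvd]
    have hq : q r ^ r' r = -1 := (hroot.pow (NeZero.pos r) hr').eq_neg_one_of_two_right
    simp [inv_pow, hq]
  · have hr' : r' r = r := by rw [r', (Nat.coprime_two_right.2 ho).gcd_eq_one, Nat.div_one]
    have hq : q r ^ r = 1 := hroot.pow_eq_one
    rw [hr', inv_pow, hq, inv_one, mul_one, (Nat.Odd.sub_odd ho odd_one).neg_one_pow]

lemma topCoeff_mul_topValue (hr : 2 < r) (b c : ℕ) :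
    qBrace r 1 ^ (r' r - 1) / qFact r (r' r - 1) *
        q r ^ ((((r' r - 1) * (r' r - 1 - 1) / 2 : ℕ) : ℤ) - 2 * b * c) * topValue r =
      (Real.sqrt (r'' r) : ℂ) * q r ^ (r' r - 1).choose 2 * qChar r (-(b * c)) := by
  have hr' := one_lt_r' hr
  have hbrace : qBrace r 1 ≠ 0 := mod_cast qBrace_ne_zero (k := 1) one_ne_zero hr'
  have hfact : qFact r (r' r - 1) ≠ 0 := qFact_ne_zero (by omega)
  have hpow : q r ^ ((((r' r - 1) * (r' r - 1 - 1) / 2 : ℕ) : ℤ) - 2 * b * c) =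
      q r ^ (r' r - 1).choose 2 * qChar r (-(b * c)) := by
    rw [zpow_sub₀ (q_ne_zero r), zpow_natCast, ← Nat.choose_two_right, AddChar.map_neg_eq_inv,
      ← Nat.cast_mul, qChar_natCast, div_eq_mul_inv, ← pow_mul, mul_assoc]
    norm_cast
  rw [hpow, topValue]
  field_simp

variable {lam : Uq r →ₗ[ℂ] ℂ}

lemma IsPreferred.apply_eq_zero_of_mem_pbwSpan (h : IsPreferred r lam) {w : Uq r}
    (hw : w ∈ pbwSpan r (r' r - 1)) : lam w = 0 := by
  refine (Submodule.mem_bot ℂ).1 (map_mem_of_mem_pbwSpan r lam (fun i j x hi => ?_) hw)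
  rw [Submodule.mem_bot]
  rcases lt_or_ge j (r' r) with hj | hj
  · rw [h.apply_pbw (by omega) hj, if_neg (by omega)]
  · rw [pbw, pow_eq_zero_of_le hj (F_pow r), mul_zero, zero_mul, map_zero]

lemma IsPreferred.apply_F_pow_mul_E_pow (h : IsPreferred r lam) {a : ℕ} (ha : a < r' r)
    (x : ZMod (r' r)) :
    lam (F r ^ a * E r ^ a * Kpow r x) = if a = r' r - 1 ∧ x = -1 then topValue r else 0 := by
  have hmem := pbwSpan_mono r (Nat.le_sub_one_of_lt ha) <|
    mul_Kpow_mem_pbwSpan r (F_pow_mul_E_pow_sub_mem_pbwSpan r a a) x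
  have hlam := h.apply_eq_zero_of_mem_pbwSpan hmem
  rw [sub_mul, map_sub, sub_eq_zero] at hlam
  have happly := h.apply_pbw ha ha x
  simp only [← and_assoc, and_self] at happly
  exact hlam.trans happly

lemma IsPreferred.apply_ribbonTerm (h : IsPreferred r lam) {a : ℕ} (ha : a < r' r) (b c : ℕ) :
    lam ((-(K r * F r)) ^ a * Kinv r ^ c * (K r ^ b * E r ^ a) * Kinv r) =
      if a = r' r - 1 ∧ (b : ZMod (r' r)) = c + 1 then topValue r else 0 := by
  rw [ribbonTerm_eq_smul, map_smul, h.apply_F_pow_mul_E_pow ha, smul_eq_mul, mul_ite, mul_zero]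
  have hiff : a = r' r - 1 ∧ (a - c + b - 1 : ZMod (r' r)) = -1 ↔
      a = r' r - 1 ∧ (b : ZMod (r' r)) = c + 1 := by
    refine and_congr_right fun htop => ?_
    rw [(natCast_eq_neg_one_iff ha).2 htop, ← sub_eq_zero, ← sub_eq_zero (a := (b : ZMod (r' r)))]
    ring_nf
  simp only [hiff]
  split_ifs with htop
  · have hzero : (a - c + b : ZMod (r' r)) = 0 := by
      linear_combination (hiff.2 htop).2
    rw [hzero, mul_zero, AddChar.map_zero_eq_one, mul_one, htop.1, neg_one_pow_mul_q_pow, one_mul]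
  · rfl

theorem IsPreferred.apply_ribbonElement (hr : 2 < r) (h : IsPreferred r lam) :
    lam (ribbonElement r) = (Real.sqrt (r'' r) : ℂ) / r' r * q r ^ (r' r - 1).choose 2 *
        ∑ c ∈ Finset.range (r' r), (q r ^ 2)⁻¹ ^ (c * (c + 1)) := by
  have hr' := one_lt_r' hr
  have hterms : lam (ribbonElement r) = 1 / r' r * ∑ c ∈ Finset.range (r' r),
      ∑ b ∈ Finset.range (r' r), if (b : ZMod (r' r)) = c + 1 then
        (Real.sqrt (r'' r) : ℂ) * q r ^ (r' r - 1).choose 2 * qChar r (-(b * c)) else 0 := by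
    rw [ribbonElement, drinfeldElement_RMatrix, smul_mul_assoc, map_smul, smul_eq_mul,
      Finset.sum_mul, map_sum,
      Finset.sum_eq_single_of_mem (r' r - 1) (Finset.mem_range.2 (by omega)), Finset.sum_comm]
    · simp only [Finset.sum_mul, smul_mul_assoc, map_sum, map_smul,
        h.apply_ribbonTerm (Nat.sub_one_lt_of_lt hr'), true_and, smul_eq_mul, mul_ite, mul_zero,
        topCoeff_mul_topValue hr]
    · intro a ha hne
      simp only [Finset.sum_mul, smul_mul_assoc, map_sum, map_smul,
        h.apply_ribbonTerm (Finset.mem_range.1 ha), hne, false_and, if_false, smul_zero,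
        Finset.sum_const_zero]
  have hsum (c : ℕ) : (∑ b ∈ Finset.range (r' r), if (b : ZMod (r' r)) = c + 1 then
      (Real.sqrt (r'' r) : ℂ) * q r ^ (r' r - 1).choose 2 * qChar r (-(b * c)) else 0) =
      (Real.sqrt (r'' r) : ℂ) * q r ^ (r' r - 1).choose 2 * (q r ^ 2)⁻¹ ^ (c * (c + 1)) := by
    rw [sum_range_natCast fun b : ZMod (r' r) => if b = c + 1 then
      (Real.sqrt (r'' r) : ℂ) * q r ^ (r' r - 1).choose 2 * qChar r (-(b * c)) else 0,
      Finset.sum_ite_eq' Finset.univ, if_pos (Finset.mem_univ _), inv_pow, ← qChar_natCast,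
      ← AddChar.map_neg_eq_inv]
    push_cast
    rw [mul_comm (c : ZMod (r' r))]
  simp only [hterms, hsum, ← Finset.mul_sum]
  ring

end

/-! ### Gauss's evaluation of the quadratic Gauss sum -/

/-- The Rogers–Szegő polynomial `∑ gauss ω i (m - i) t ^ i` as a function of `t`, defined by its
`q`-difference recursion; its value at `t = -1` is Gauss's alternating sum. -/
def rogersSzego (ω : ℂ) : ℕ → ℂ → ℂ
  | 0, _ => 1
  | m + 1, t => t * rogersSzego ω m t + rogersSzego ω m (ω * t)

section

variable (ω : ℂ)

lemma rogersSzego_eq_sum (m : ℕ) (t : ℂ) : rogersSzego ω m t =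
    ∑ s ∈ Finset.HasAntidiagonal.antidiagonal m, gauss ω s.1 s.2 * t ^ s.1 := by
  let X : Module.End ℂ (ℂ → ℂ) := LinearMap.mulLeft ℂ id
  let Y : Module.End ℂ (ℂ → ℂ) := LinearMap.funLeft ℂ ℂ (ω * ·)
  have hcomm : Y * X = ω • (X * Y) :=
    LinearMap.ext fun φ => funext fun t => mul_assoc ω t (φ (ω * t))
  have hX (i : ℕ) : ((X ^ i) 1) t = t ^ i := by
    simp [X, LinearMap.pow_mulLeft]
  have hY (j : ℕ) : (Y ^ j) 1 = 1 := by
    induction j with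
    | zero => rfl
    | succ j ih => rw [pow_succ', Module.End.mul_apply, ih]; rfl
  have hiter (m : ℕ) : rogersSzego ω m = ((X + Y) ^ m) 1 := by
    induction m with
    | zero => rfl
    | succ m ih =>
      rw [pow_succ', Module.End.mul_apply, ← ih]
      rfl
  rw [hiter, add_pow_qcomm hcomm, LinearMap.sum_apply, Finset.sum_apply]
  refine Finset.sum_congr rfl fun s _ => ?_
  rw [LinearMap.smul_apply, Module.End.mul_apply, hY, Pi.smul_apply, hX, smul_eq_mul]

lemma rogersSzego_succ_mul (m : ℕ) (t : ℂ) : rogersSzego ω (m + 1) (ω * t) =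
    rogersSzego ω m (ω * t) + ω ^ (m + 1) * t * rogersSzego ω m t := by
  induction m generalizing t with
  | zero => simp [rogersSzego, add_comm]
  | succ m ih =>
    have hrec := ih t
    rw [rogersSzego] at hrec
    rw [rogersSzego, ih t, ih (ω * t), rogersSzego]
    linear_combination hrec

lemma rogersSzego_neg_one_add_two (m : ℕ) :
    rogersSzego ω (m + 2) (-1) = (1 - ω ^ (m + 1)) * rogersSzego ω m (-1) := by
  rw [rogersSzego, rogersSzego_succ_mul, rogersSzego]
  ring

lemma rogersSzego_neg_one_two_mul (p : ℕ) :
    rogersSzego ω (2 * p) (-1) = ∏ k ∈ Finset.range p, (1 - ω ^ (2 * k + 1)) := by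
  induction p with
  | zero => rfl
  | succ p ih =>
    rw [Nat.mul_succ, rogersSzego_neg_one_add_two, ih, Finset.prod_range_succ, mul_comm]

end

lemma gauss_mul_pow_choose_two {ω : ℂ} {n : ℕ} (hω : IsPrimitiveRoot ω n) {i j : ℕ}
    (h : i + j + 1 = n) : gauss ω i j * ω ^ (i + 1).choose 2 = (-1) ^ i := by
  induction i generalizing j with
  | zero => simp [gauss_zero_left]
  | succ i ih =>
    obtain ⟨hleft, hright⟩ := gauss_step ω (i + j) i j rfl
    have hne : 1 - ω ^ (i + 1) ≠ 0 :=
      sub_ne_zero.2 (hω.pow_ne_one_of_pos_of_lt (by omega) (by omega)).symm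
    have hprod : ω ^ (j + 1) * ω ^ (i + 1) = 1 := by
      rw [← pow_add, ← hω.pow_eq_one]; congr 1; omega
    have hstep : gauss ω (i + 1) j * ω ^ (i + 1) = -gauss ω i (j + 1) := by
      apply mul_left_cancel₀ hne
      linear_combination ω ^ (i + 1) * (hleft - hright) - gauss ω i (j + 1) * hprod
    calc gauss ω (i + 1) j * ω ^ (i + 2).choose 2
        = gauss ω (i + 1) j * ω ^ (i + 1) * ω ^ (i + 1).choose 2 := by
          rw [Nat.choose_succ_succ' (i + 1), Nat.choose_one_right, pow_add, mul_assoc]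
      _ = (-1) ^ (i + 1) := by
          rw [hstep, neg_mul, ih (by omega), pow_succ, mul_neg_one]

theorem sum_inv_pow_choose_two_eq_prod {ω : ℂ} {p : ℕ} (hω : IsPrimitiveRoot ω (2 * p + 1)) :
    ∑ i ∈ Finset.range (2 * p + 1), ω⁻¹ ^ (i + 1).choose 2 =
      ∏ k ∈ Finset.range p, (1 - ω ^ (2 * k + 1)) := by
  rw [← rogersSzego_neg_one_two_mul, rogersSzego_eq_sum,
    Finset.Nat.sum_antidiagonal_eq_sum_range_succ_mk]
  refine Finset.sum_congr rfl fun i hi => ?_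
  have hgauss := gauss_mul_pow_choose_two hω (i := i) (j := 2 * p - i)
    (by have := Finset.mem_range.1 hi; omega)
  rw [inv_pow]
  refine inv_eq_of_mul_eq_one_left ?_
  rw [mul_right_comm, hgauss, ← mul_pow, neg_one_mul, neg_neg, one_pow]

lemma prod_range_two_mul {M : Type*} [CommMonoid M] (f : ℕ → M) (m : ℕ) :
    ∏ k ∈ Finset.range (2 * m), f k = ∏ k ∈ Finset.range m, f (2 * k) * f (2 * k + 1) := by
  induction m with
  | zero => rfl
  | succ m ih =>
    rw [Nat.mul_succ, Finset.prod_range_succ, Finset.prod_range_succ, ih, Finset.prod_range_succ,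
      mul_assoc]

lemma norm_prod_one_sub_pow {ω : ℂ} {p : ℕ} (hω : IsPrimitiveRoot ω (2 * p + 1)) :
    ‖∏ k ∈ Finset.range p, (1 - ω ^ (2 * k + 1))‖ = √(2 * p + 1 : ℕ) := by
  have hnorm : ‖ω‖ = 1 := hω.norm'_eq_one (Nat.succ_ne_zero _)
  have hconj {k : ℕ} (hk : k ∈ Finset.range p) :
      ‖1 - ω ^ (2 * (p - 1 - k) + 1 + 1)‖ = ‖1 - ω ^ (2 * k + 1)‖ := by
    have hk := Finset.mem_range.1 hk
    have hprod : ω ^ (2 * (p - 1 - k) + 1 + 1) * ω ^ (2 * k + 1) = 1 := by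
      rw [← pow_add, ← hω.pow_eq_one]; congr 1; omega
    rw [eq_inv_of_mul_eq_one_left hprod, ← inv_pow, Complex.inv_eq_conj hnorm, ← Complex.norm_conj]
    simp
  have heven : ‖∏ k ∈ Finset.range p, (1 - ω ^ (2 * k + 1 + 1))‖ =
      ‖∏ k ∈ Finset.range p, (1 - ω ^ (2 * k + 1))‖ := by
    rw [norm_prod, norm_prod, ← Finset.prod_range_reflect]
    exact Finset.prod_congr rfl fun k => hconj
  have hall := congrArg norm hω.prod_one_sub_pow_eq_order
  rw [prod_range_two_mul, Finset.prod_mul_distrib, norm_mul, heven] at hall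
  rw [eq_comm, Real.sqrt_eq_iff_mul_self_eq (Nat.cast_nonneg _) (norm_nonneg _), hall]
  norm_cast

lemma one_sub_sq_eq_norm_mul {w : ℂ} (hw : ‖w‖ = 1) (him : 0 ≤ w.im) :
    1 - w ^ 2 = ‖1 - w ^ 2‖ * (-Complex.I * w) := by
  have hone : w * (starRingEnd ℂ) w = 1 := by
    rw [Complex.mul_conj', hw, Complex.ofReal_one, one_pow]
  have hpolar : 1 - w ^ 2 = (2 * w.im : ℝ) * (-Complex.I * w) := by
    linear_combination -hone - w * Complex.sub_conj w
  have hnorm : ‖1 - w ^ 2‖ = 2 * w.im := by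
    rw [hpolar, norm_mul, norm_mul, norm_neg, Complex.norm_I, hw, one_mul, mul_one,
      Complex.norm_of_nonneg (by positivity)]
  rw [hnorm, hpolar]

theorem sum_inv_pow_choose_two_eq_sqrt_mul {ω : ℂ} {p : ℕ} (hω : IsPrimitiveRoot ω (2 * p + 1))
    {w : ℕ → ℂ} (hw : ∀ k < p, w k ^ 2 = ω ^ (2 * k + 1)) (him : ∀ k < p, 0 ≤ (w k).im) :
    ∑ i ∈ Finset.range (2 * p + 1), ω⁻¹ ^ (i + 1).choose 2 =
      √(2 * p + 1 : ℕ) * ∏ k ∈ Finset.range p, (-Complex.I * w k) := by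
  have hfactor {k : ℕ} (hk : k ∈ Finset.range p) :
      1 - ω ^ (2 * k + 1) = ‖1 - ω ^ (2 * k + 1)‖ * (-Complex.I * w k) := by
    have hk := Finset.mem_range.1 hk
    have hnorm : ‖w k‖ = 1 := by
      rw [← pow_eq_one_iff_of_nonneg (norm_nonneg _) two_ne_zero, ← norm_pow, hw k hk, norm_pow,
        hω.norm'_eq_one (Nat.succ_ne_zero _), one_pow]
    rw [← hw k hk]
    exact one_sub_sq_eq_norm_mul hnorm (him k hk)
  rw [sum_inv_pow_choose_two_eq_prod hω, Finset.prod_congr rfl fun k => hfactor,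
    Finset.prod_mul_distrib, ← Complex.ofReal_prod, ← norm_prod, norm_prod_one_sub_pow hω]

lemma sum_range_mul_add {A : Type*} [AddCommMonoid A] {n a : ℕ} [NeZero n] (ha : n.Coprime a)
    (h : ℕ) {f : ℕ → A} (hf : Function.Periodic f n) :
    ∑ c ∈ Finset.range n, f (a * c + h) = ∑ j ∈ Finset.range n, f j := by
  have hmaps : Set.MapsTo (fun c => (a * c + h) % n) (Finset.range n) (Finset.range n) :=
    fun c _ => Finset.mem_coe.2 (Finset.mem_range.2 (Nat.mod_lt _ (NeZero.pos n)))
  have hinj : Set.InjOn (fun c => (a * c + h) % n) (Finset.range n) := by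
    intro c hc d hd hcd
    have hmod : c ≡ d [MOD n] :=
      Nat.ModEq.cancel_left_of_coprime ha (Nat.ModEq.add_right_cancel' h hcd)
    exact hmod.eq_of_lt_of_lt (Finset.mem_range.1 hc) (Finset.mem_range.1 hd)
  exact Finset.sum_nbij (fun c => (a * c + h) % n) hmaps hinj
    (Finset.surjOn_of_injOn_of_card_le _ hmaps hinj le_rfl) fun c _ => (hf.map_mod_nat _).symm

lemma inv_pow_choose_two_periodic {ω : ℂ} {p : ℕ} (hω : ω ^ (2 * p + 1) = 1) :
    Function.Periodic (fun i => ω⁻¹ ^ (i + 1).choose 2) (2 * p + 1) := by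
  intro i
  have hchoose : (i + (2 * p + 1) + 1).choose 2 =
      (i + 1).choose 2 + (2 * p + 1) * (i + p + 1) := by
    qify
    simp only [Nat.cast_choose_two]
    push_cast
    ring
  simp only
  rw [hchoose, pow_add, pow_mul, inv_pow ω (2 * p + 1), hω, inv_one, one_pow, mul_one]

/-- Completing the square: `c ↦ 2 * c + p + 1` permutes the residues modulo `2 * p + 1`. -/
lemma sum_inv_sq_pow_mul_succ {ω : ℂ} {p : ℕ} (hω : ω ^ (2 * p + 1) = 1) :
    ∑ c ∈ Finset.range (2 * p + 1), (ω ^ 2)⁻¹ ^ (c * (c + 1)) =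
      ω ^ (p + 2).choose 2 * ∑ i ∈ Finset.range (2 * p + 1), ω⁻¹ ^ (i + 1).choose 2 := by
  have hne : ω ≠ 0 := by rintro rfl; simp at hω
  have hchoose (c : ℕ) : (2 * c + (p + 1) + 1).choose 2 =
      (p + 2).choose 2 + (2 * p + 1) * c + 2 * (c * (c + 1)) := by
    qify
    simp only [Nat.cast_choose_two]
    push_cast
    ring
  rw [← sum_range_mul_add (Nat.coprime_two_right.2 (odd_two_mul_add_one p)) (p + 1)
    (inv_pow_choose_two_periodic hω), Finset.mul_sum]
  refine Finset.sum_congr rfl fun c _ => ?_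
  rw [hchoose, pow_add, pow_add, pow_mul _ (2 * p + 1), inv_pow ω (2 * p + 1), hω, inv_one,
    one_pow, mul_one, ← mul_assoc, ← mul_pow, mul_inv_cancel₀ hne, one_pow, one_mul, pow_mul ω⁻¹ 2,
    inv_pow ω 2]

/-! ### The value of the stabilization coefficient -/

lemma q_mul_pow {k : ℕ} (hk : k ≠ 0) (m : ℕ) : q (k * m) ^ k = q m := by
  have hk' : (k : ℂ) ≠ 0 := Nat.cast_ne_zero.2 hk
  rw [q, q, ← Complex.exp_nat_mul, Nat.cast_mul, ← mul_div_assoc, mul_div_mul_left _ _ hk']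

lemma isPrimitiveRoot_q {m : ℕ} (hm : m ≠ 0) : IsPrimitiveRoot (q m) m :=
  Complex.isPrimitiveRoot_exp m hm

lemma q_four_mul_pow {n : ℕ} (hn : n ≠ 0) : q (4 * n) ^ n = Complex.I := by
  rw [mul_comm, q_mul_pow hn, ← Complex.exp_pi_div_two_mul_I, q, Nat.cast_ofNat]
  congr 1
  ring

lemma im_q_pow_nonneg {m j : ℕ} (h : 2 * j ≤ m) : 0 ≤ (q m ^ j).im := by
  rcases eq_or_ne m 0 with rfl | hm
  · rw [Nat.le_zero.1 (by omega : j ≤ 0), pow_zero, Complex.one_im]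
  have hm' : (0 : ℝ) < m := Nat.cast_pos.2 (Nat.pos_of_ne_zero hm)
  have hexp : q m ^ j = Complex.exp ((Real.pi * (2 * j / m) : ℝ) * Complex.I) := by
    rw [q, ← Complex.exp_nat_mul]
    congr 1
    push_cast
    ring
  rw [hexp, Complex.exp_ofReal_mul_I_im]
  refine Real.sin_nonneg_of_nonneg_of_le_pi (by positivity)
    (mul_le_of_le_one_right Real.pi_nonneg ?_)
  rw [div_le_one hm']
  exact_mod_cast h

lemma prod_range_pow_two_mul_add_one {M : Type*} [CommMonoid M] (u : M) (p : ℕ) :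
    ∏ k ∈ Finset.range p, u ^ (2 * k + 1) = u ^ p ^ 2 := by
  induction p with
  | zero => simp
  | succ p ih => rw [Finset.prod_range_succ, ih, ← pow_add]; congr 1; ring

lemma q_two_mul (n : ℕ) : q (2 * n) = q (4 * n) ^ 2 := by
  change _ = q (2 * 2 * n) ^ 2
  rw [mul_assoc, q_mul_pow two_ne_zero]

section

variable (p : ℕ)

lemma q_four_mul_odd_pow : q (4 * (2 * p + 1)) ^ (2 * p + 1) = Complex.I :=
  q_four_mul_pow (Nat.succ_ne_zero _)

theorem sum_inv_q_pow_choose_two :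
    ∑ i ∈ Finset.range (2 * p + 1), (q (2 * p + 1))⁻¹ ^ (i + 1).choose 2 =
      (q (4 * (2 * p + 1)))⁻¹ ^ p * √(2 * p + 1 : ℕ) := by
  have hroot : ∀ k < p, (q (2 * (2 * p + 1)) ^ (2 * k + 1)) ^ 2 = q (2 * p + 1) ^ (2 * k + 1) :=
    fun k _ => by rw [pow_right_comm, q_mul_pow two_ne_zero]
  rw [sum_inv_pow_choose_two_eq_sqrt_mul (isPrimitiveRoot_q (Nat.succ_ne_zero _)) hroot
    fun k hk => im_q_pow_nonneg (by omega), Finset.prod_mul_distrib, Finset.prod_const,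
    Finset.card_range, prod_range_pow_two_mul_add_one, mul_comm, q_two_mul, inv_pow]
  congr 1
  refine eq_inv_of_mul_eq_one_left ?_
  have hpow : (q (4 * (2 * p + 1)) ^ 2) ^ p ^ 2 * q (4 * (2 * p + 1)) ^ p =
      (q (4 * (2 * p + 1)) ^ (2 * p + 1)) ^ p := by ring
  rw [mul_assoc, hpow, q_four_mul_odd_pow, ← mul_pow, neg_mul, Complex.I_mul_I, neg_neg, one_pow]

theorem sum_inv_q_four_mul_sq_pow_mul_succ :
    ∑ c ∈ Finset.range (2 * (2 * p + 1)), (q (4 * (2 * p + 1)) ^ 2)⁻¹ ^ (c * (c + 1)) =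
      2 * ((q (4 * (2 * p + 1)))⁻¹ ^ p * √(2 * p + 1 : ℕ)) := by
  have hchoose (c : ℕ) : (q (4 * (2 * p + 1)) ^ 2)⁻¹ ^ (c * (c + 1)) =
      (q (2 * p + 1))⁻¹ ^ (c + 1).choose 2 := by
    have hdouble : c * (c + 1) = 2 * (c + 1).choose 2 := by
      qify
      rw [Nat.cast_choose_two]
      push_cast
      ring
    rw [hdouble, pow_mul, ← q_mul_pow four_ne_zero (2 * p + 1), inv_pow, ← pow_mul]
  simp only [hchoose]
  rw [two_mul (2 * p + 1), ← sum_inv_q_pow_choose_two, Finset.sum_range_add,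
    two_mul (∑ i ∈ _, _)]
  congr 1
  refine Finset.sum_congr rfl fun c _ => ?_
  rw [add_comm (2 * p + 1) c]
  exact inv_pow_choose_two_periodic (isPrimitiveRoot_q (Nat.succ_ne_zero _)).pow_eq_one c

lemma isPrimitiveRoot_neg_q_two_mul_odd : IsPrimitiveRoot (-q (2 * (2 * p + 1))) (2 * p + 1) := by
  have hpow : -q (2 * (2 * p + 1)) = q (2 * p + 1) ^ (p + 1) := by
    rw [← q_mul_pow two_ne_zero (2 * p + 1), q_two_mul, ← pow_mul, ← pow_mul,
      show 2 * (2 * (p + 1)) = (2 * p + 1) * 2 + 2 by ring, pow_add, pow_mul _ _ 2,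
      q_four_mul_odd_pow, Complex.I_sq, neg_one_mul]
  have hcoprime : (p + 1).Coprime (2 * p + 1) := by
    rw [show 2 * p + 1 = p + (p + 1) by ring]
    simp
  rw [hpow]
  exact (isPrimitiveRoot_q (Nat.succ_ne_zero _)).pow_of_coprime _ hcoprime

theorem sum_inv_neg_q_pow_choose_two :
    ∑ i ∈ Finset.range (2 * p + 1), (-q (2 * (2 * p + 1)))⁻¹ ^ (i + 1).choose 2 =
      q (4 * (2 * p + 1)) ^ p ^ 2 * √(2 * p + 1 : ℕ) := by
  have hpow (k : ℕ) : q (4 * (2 * p + 1)) ^ (2 * p + 1 + (2 * k + 1)) =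
      Complex.I * q (4 * (2 * p + 1)) ^ (2 * k + 1) := by rw [pow_add, q_four_mul_odd_pow]
  have hroot : ∀ k < p, (q (4 * (2 * p + 1)) ^ (2 * p + 1 + (2 * k + 1))) ^ 2 =
      (-q (2 * (2 * p + 1))) ^ (2 * k + 1) := fun k _ => by
    rw [hpow, mul_pow, Complex.I_sq, pow_right_comm, ← q_two_mul, neg_one_mul,
      (odd_two_mul_add_one k).neg_pow]
  rw [sum_inv_pow_choose_two_eq_sqrt_mul (isPrimitiveRoot_neg_q_two_mul_odd p) hroot
    fun k hk => im_q_pow_nonneg (by omega), mul_comm, ← prod_range_pow_two_mul_add_one]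
  congr 1
  refine Finset.prod_congr rfl fun k _ => ?_
  rw [hpow, ← mul_assoc, neg_mul, Complex.I_mul_I, neg_neg, one_mul]

lemma jacobiSym_two_two_mul_add_one :
    jacobiSym 2 (2 * p + 1) = (-1) ^ (p + 1).choose 2 := by
  induction p using Nat.strong_induction_on with
  | _ p ih =>
    match p with
    | 0 => norm_num
    | 1 => norm_num
    | 2 => norm_num
    | 3 => norm_num [Nat.choose]
    | p + 4 =>
      have hmod :
          (2 * (p + 4) + 1) % (4 * (2 : ℤ).natAbs) = (2 * p + 1) % (4 * (2 : ℤ).natAbs) := by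
        change _ % 8 = _ % 8
        omega
      have hchoose : (p + 4 + 1).choose 2 = (p + 1).choose 2 + 2 * (2 * p + 5) := by
        qify
        simp only [Nat.cast_choose_two]
        push_cast
        ring
      rw [jacobiSym.mod_right 2 (odd_two_mul_add_one _), hmod,
        ← jacobiSym.mod_right 2 (odd_two_mul_add_one _), ih p (by omega), hchoose,
        pow_add, pow_mul, neg_one_sq, one_pow, mul_one]

end

lemma sqrt_div_mul_sqrt {n : ℕ} (hn : n ≠ 0) : (√n : ℂ) / n * √n = 1 := by
  rw [div_mul_eq_mul_div, ← Complex.ofReal_mul, Real.mul_self_sqrt (Nat.cast_nonneg n),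
    Complex.ofReal_natCast, div_self (Nat.cast_ne_zero.2 hn)]

lemma pow_eq_pow_of_add_mul_eq {M : Type*} [Monoid M] {y : M} {N a b s t : ℕ} (hy : y ^ N = 1)
    (h : a + N * s = b + N * t) : y ^ a = y ^ b :=
  pow_eq_pow_of_modEq (by simpa [Nat.ModEq] using congrArg (· % N) h) hy

lemma r'_odd (p : ℕ) : r' (2 * p + 1) = 2 * p + 1 := by
  rw [r', (Nat.coprime_two_right.2 (odd_two_mul_add_one p)).gcd_eq_one, Nat.div_one]

lemma r''_odd (p : ℕ) : r'' (2 * p + 1) = 2 * p + 1 := by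
  have hcoprime : (2 * p + 1).Coprime (2 ^ 2) :=
    (Nat.coprime_two_right.2 (odd_two_mul_add_one p)).pow_right 2
  rw [r'', show 4 = 2 ^ 2 by rfl, hcoprime.gcd_eq_one, Nat.div_one]

lemma r'_two_mul (m : ℕ) : r' (2 * m) = m := by
  rw [r', Nat.gcd_mul_right_left, Nat.mul_div_cancel_left _ two_pos]

lemma r''_two_mul_odd (p : ℕ) : r'' (2 * (2 * p + 1)) = 2 * p + 1 := by
  rw [r'', show 4 = 2 * 2 by rfl, Nat.gcd_mul_left, Nat.mul_div_mul_left _ _ two_pos]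
  exact r'_odd p

lemma r''_four_mul (m : ℕ) : r'' (4 * m) = m := by
  rw [r'', Nat.gcd_mul_right_left, Nat.mul_div_cancel_left _ four_pos]

theorem IsPreferred.apply_ribbonElement_odd {p : ℕ} (hp : 0 < p) {lam : Uq (2 * p + 1) →ₗ[ℂ] ℂ}
    (h : IsPreferred (2 * p + 1) lam) :
    lam (ribbonElement (2 * p + 1)) = Complex.I ^ p * q (2 * p + 1) ^ (p + 2) := by
  have hvalue : (q (4 * (2 * p + 1)) ^ 4) ^ (2 * p).choose 2 *
      (q (4 * (2 * p + 1)) ^ 4) ^ (p + 2).choose 2 =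
      Complex.I ^ p * (q (4 * (2 * p + 1)) ^ 4) ^ (p + 2) * q (4 * (2 * p + 1)) ^ p := by
    rw [← q_four_mul_odd_pow p]
    simp only [← pow_mul, ← pow_add]
    refine pow_eq_pow_of_add_mul_eq (s := 1) (t := p)
      (isPrimitiveRoot_q (by omega : 4 * (2 * p + 1) ≠ 0)).pow_eq_one ?_
    qify
    simp only [Nat.cast_choose_two]
    push_cast
    ring
  rw [h.apply_ribbonElement (by omega), r'_odd, r''_odd,
    sum_inv_sq_pow_mul_succ (isPrimitiveRoot_q (Nat.succ_ne_zero _)).pow_eq_one,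
    sum_inv_q_pow_choose_two, ← q_mul_pow four_ne_zero (2 * p + 1), Nat.add_sub_cancel]
  have hinv : (q (4 * (2 * p + 1)))⁻¹ ^ p * q (4 * (2 * p + 1)) ^ p = 1 := by
    rw [← mul_pow, inv_mul_cancel₀ (q_ne_zero _), one_pow]
  have hsqrt := sqrt_div_mul_sqrt (Nat.succ_ne_zero (2 * p))
  generalize q (4 * (2 * p + 1)) = y at *
  linear_combination (y ^ 4) ^ (2 * p).choose 2 * (y ^ 4) ^ (p + 2).choose 2 * y⁻¹ ^ p * hsqrt +
    y⁻¹ ^ p * hvalue + Complex.I ^ p * (y ^ 4) ^ (p + 2) * hinv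

theorem IsPreferred.apply_ribbonElement_two_mul_odd {p : ℕ} (hp : 0 < p)
    [NeZero (2 * (2 * p + 1))] {lam : Uq (2 * (2 * p + 1)) →ₗ[ℂ] ℂ}
    (h : IsPreferred (2 * (2 * p + 1)) lam) :
    lam (ribbonElement (2 * (2 * p + 1))) =
      (jacobiSym 2 (2 * p + 1) : ℂ) * Complex.I ^ p * q (2 * (2 * p + 1)) ^ (p + 2) := by
  have hvalue : (q (4 * (2 * p + 1)) ^ 2) ^ (2 * p).choose 2 *
      (-q (4 * (2 * p + 1)) ^ 2) ^ (p + 2).choose 2 * q (4 * (2 * p + 1)) ^ p ^ 2 =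
      (-1) ^ (p + 1).choose 2 * Complex.I ^ p * (q (4 * (2 * p + 1)) ^ 2) ^ (p + 2) := by
    rw [neg_pow, ← Complex.I_sq, ← q_four_mul_odd_pow p]
    simp only [← pow_mul, ← pow_add]
    refine pow_eq_pow_of_add_mul_eq (s := 0) (t := p)
      (isPrimitiveRoot_q (by omega : 4 * (2 * p + 1) ≠ 0)).pow_eq_one ?_
    qify
    simp only [Nat.cast_choose_two]
    push_cast
    ring
  rw [h.apply_ribbonElement (by omega), r'_two_mul, r''_two_mul_odd, ← neg_sq (q _),
    sum_inv_sq_pow_mul_succ (isPrimitiveRoot_neg_q_two_mul_odd p).pow_eq_one,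
    sum_inv_neg_q_pow_choose_two, q_two_mul, Nat.add_sub_cancel, jacobiSym_two_two_mul_add_one]
  have hsqrt := sqrt_div_mul_sqrt (Nat.succ_ne_zero (2 * p))
  simp only [Int.cast_pow, Int.cast_neg, Int.cast_one]
  generalize q (4 * (2 * p + 1)) = y at *
  linear_combination (y ^ 2) ^ (2 * p).choose 2 * (-y ^ 2) ^ (p + 2).choose 2 * y ^ p ^ 2 * hsqrt +
    hvalue

theorem IsPreferred.apply_ribbonElement_four_mul_odd {p : ℕ}
    [NeZero (4 * (2 * p + 1))] {lam : Uq (4 * (2 * p + 1)) →ₗ[ℂ] ℂ}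
    (h : IsPreferred (4 * (2 * p + 1)) lam) :
    lam (ribbonElement (4 * (2 * p + 1))) = -q (4 * (2 * p + 1)) ^ (p + 2) := by
  have hr' : r' (4 * (2 * p + 1)) = 2 * (2 * p + 1) := by
    change r' (2 * 2 * (2 * p + 1)) = _
    rw [mul_assoc, r'_two_mul]
  have hvalue : q (4 * (2 * p + 1)) ^ (4 * p + 1).choose 2 =
      -q (4 * (2 * p + 1)) ^ (p + 2) * q (4 * (2 * p + 1)) ^ p := by
    rw [neg_mul, ← neg_one_mul, ← Complex.I_sq, ← q_four_mul_odd_pow p]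
    simp only [← pow_mul, ← pow_add]
    refine pow_eq_pow_of_add_mul_eq (s := 1) (t := p)
      (isPrimitiveRoot_q (by omega : 4 * (2 * p + 1) ≠ 0)).pow_eq_one ?_
    qify
    simp only [Nat.cast_choose_two]
    push_cast
    ring
  rw [h.apply_ribbonElement (by omega), hr', r''_four_mul,
    sum_inv_q_four_mul_sq_pow_mul_succ, show 2 * (2 * p + 1) - 1 = 4 * p + 1 by omega, hvalue,
    Nat.cast_mul, Nat.cast_ofNat]
  have hinv : (q (4 * (2 * p + 1)))⁻¹ ^ p * q (4 * (2 * p + 1)) ^ p = 1 := by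
    rw [← mul_pow, inv_mul_cancel₀ (q_ne_zero _), one_pow]
  have hsqrt := sqrt_div_mul_sqrt (Nat.succ_ne_zero (2 * p))
  generalize q (4 * (2 * p + 1)) = y at *
  linear_combination -y ^ (p + 2) * (y ^ p * y⁻¹ ^ p * hsqrt + hinv)

theorem IsPreferred.apply_ribbonElement_eight_mul {k : ℕ} [NeZero (8 * k)]
    {lam : Uq (8 * k) →ₗ[ℂ] ℂ} (h : IsPreferred (8 * k) lam) :
    lam (ribbonElement (8 * k)) = 0 := by
  have hk : 8 * k ≠ 0 := NeZero.ne _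
  have hr' : r' (8 * k) = 2 * k + 2 * k := by
    rw [show 8 * k = 2 * (2 * k + 2 * k) by ring, r'_two_mul]
  have hneg : ((q (8 * k) ^ 2)⁻¹) ^ (2 * k) = -1 := by
    have hprim := (isPrimitiveRoot_q_sq hk).inv
    rw [hr', ← mul_two] at hprim
    exact (hprim.pow (by omega) rfl).eq_neg_one_of_two_right
  have hsum : ∑ c ∈ Finset.range (2 * k + 2 * k), (q (8 * k) ^ 2)⁻¹ ^ (c * (c + 1)) = 0 := by
    rw [Finset.sum_range_add, ← Finset.sum_add_distrib]
    refine Finset.sum_eq_zero fun c _ => ?_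
    have hexp : (2 * k + c) * (2 * k + c + 1) = c * (c + 1) + 2 * k * (2 * (c + k) + 1) := by
      ring
    rw [hexp, pow_add, pow_mul _ (2 * k), hneg, (odd_two_mul_add_one _).neg_one_pow, mul_neg_one,
      add_neg_cancel]
  rw [h.apply_ribbonElement (by omega), hr', hsum, mul_zero]

end

end SmallQuantum

theorem lemmaL (r : ℕ) [NeZero r] (hr : 2 < r) :
    (∃! lam : SmallQuantum.Uq r →ₗ[ℂ] ℂ, SmallQuantum.IsPreferred r lam) ∧
    ∀ lam : SmallQuantum.Uq r →ₗ[ℂ] ℂ, SmallQuantum.IsPreferred r lam →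
      SmallQuantum.IsLeftIntegral lam ∧
      (r % 2 = 1 →
        lam (SmallQuantum.ribbonElement r) =
          Complex.I ^ ((r - 1) / 2) * SmallQuantum.q r ^ ((r + 3) / 2)) ∧
      (r % 4 = 2 →
        lam (SmallQuantum.ribbonElement r) =
          (jacobiSym 2 (SmallQuantum.r' r) : ℂ) * Complex.I ^ ((SmallQuantum.r' r - 1) / 2) *
            SmallQuantum.q r ^ ((SmallQuantum.r' r + 3) / 2)) ∧
      (r % 8 = 4 →
        lam (SmallQuantum.ribbonElement r) =
          -SmallQuantum.q r ^ ((SmallQuantum.r'' r + 3) / 2)) ∧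
      (r % 8 = 0 → lam (SmallQuantum.ribbonElement r) = 0) := by
  refine ⟨⟨SmallQuantum.integral r, SmallQuantum.isPreferred_integral r,
    fun _ h => h.unique (SmallQuantum.isPreferred_integral r)⟩,
    fun lam hlam => ⟨hlam.isLeftIntegral, fun h => ?_, fun h => ?_, fun h => ?_, fun h => ?_⟩⟩
  · obtain ⟨p, rfl⟩ : ∃ p, r = 2 * p + 1 := ⟨r / 2, by omega⟩
    rw [hlam.apply_ribbonElement_odd (by omega), show (2 * p + 1 - 1) / 2 = p by omega,
      show (2 * p + 1 + 3) / 2 = p + 2 by omega]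
  · obtain ⟨p, rfl⟩ : ∃ p, r = 2 * (2 * p + 1) := ⟨r / 4, by omega⟩
    rw [hlam.apply_ribbonElement_two_mul_odd (by omega), SmallQuantum.r'_two_mul,
      show (2 * p + 1 - 1) / 2 = p by omega, show (2 * p + 1 + 3) / 2 = p + 2 by omega]
  · obtain ⟨p, rfl⟩ : ∃ p, r = 4 * (2 * p + 1) := ⟨r / 8, by omega⟩
    rw [hlam.apply_ribbonElement_four_mul_odd, SmallQuantum.r''_four_mul,
      show (2 * p + 1 + 3) / 2 = p + 2 by omega]
  · obtain ⟨k, rfl⟩ : ∃ k, r = 8 * k := ⟨r / 8, by omega⟩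
    exact hlam.apply_ribbonElement_eight_mul
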